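/- Let $G$ be a (real) semisimple Lie group with Lie algebra $\mathfrak g$ and Killing form $B$, let $P\subset G$ be a parabolic subgroup (a closed subgroup whose Lie algebra is a parabolic subalgebra of $\mathfrak g$), and let $\rho$ be a finite dimensional continuous representation of $P$ on a real vector space $W$. A parabolic geometry of type $(G,P)$ is a smooth principal $P$-bundle $p:\mathcal G\to M$ with $\dim M=\dim G/P$ together with a Cartan connection $\omega\in\Omega^1(\mathcal G,\mathfrak g)$: each $\omega_u:T_u\mathcal G\to\mathfrak g$ is a linear isomorphism, $\omega$ is $P$-equivariant, i.e. $(r^h)^*\omega=\mathrm{Ad}(h^{-1})\circ\omega$ for $h\in P$, and $\omega$ reproduces the generators of fundamental vector fields. The homogeneous model is $G\to G/P$ with the left Maurer–Cartan form. For a finite dimensional representation $V$ of $P$, put $VM=\mathcal G\times_PV$ and identify $\Gamma(VM)$ with $C^\infty(\mathcal G,V)^P=\{f\in C^\infty(\mathcal G,V): f(u\cdot h)=h^{-1}\cdot f(u)\ \ \forall u\in\mathcal G,\ h\in P\}$. Let $\mathcal AM=\mathcal G\times_P\mathfrak g$ be the adjoint tractor bundle. The fundamental derivative $D:\Gamma(VM)\to\Gamma(\mathcal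 A^*M\otimes VM)$ is defined by $(Df)(u)(X)=df_u(\omega_u^{-1}(X))$ for $X\in\mathfrak g$. Write $D^2=D\circ D:\Gamma(WM)\to\Gamma(\otimes^2\mathcal A^*M\otimes WM)$, and let $B\otimes\mathrm{id}:\Gamma(\otimes^2\mathcal A^*M\otimes WM)\to\Gamma(WM)$ be the contraction with the form on $\mathfrak g^*$ induced by $B$ via $\mathfrak g\cong\mathfrak g^*$. The group $G$ acts on $\Gamma(G\times_PW)=C^\infty(G,W)^P$ by $(g\cdot f)(\tilde g)=f(g^{-1}\tilde g)$. The Casimir operator of the derived action of $\mathfrak g$ is $\mathcal C(f)=\sum_\ell \xi^\ell\cdot\xi_\ell\cdot f$, where $\{\xi^\ell\}$ is any basis of $\mathfrak g$ and $\{\xi_\ell\}$ is its dual basis with respect to $B$. Proposition 2.4. (1) On the homogeneous model, $D$ and $D^2$ map $\Gamma(W(G/P))$ to $\Gamma(\mathcal A^*(G/P)\otimes W(G/P))$ and $\Gamma(\otimes^2\mathcal A^*(G/P)\otimes W(G/P))$, and for every choice of the basis $\{\xi^\ell\}$, $$\mathcal C=(B\otimes\mathrm{id})\circ D^2:\Gamma(W(G/P))\to\Gamma(W(G/P)).$$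 (2) Hence $(B\otimes\mathrm{id})\circ D^2$ extends $\mathcal C$ to an invariant differential operator on all parabolic geometries of type $(G,P)$. That is: on every parabolic geometry $(p:\mathcal G\to M,\omega)$ of type $(G,P)$, $D$ and $D^2$ are well defined on $\Gamma(WM)$ as above, and $(B\otimes\mathrm{id})\circ D^2:\Gamma(WM)\to\Gamma(WM)$ is a linear differential operator, of order at most $2$; and for every morphism $\Phi:\mathcal G\to\mathcal G'$ of parabolic geometries of type $(G,P)$ (a smooth $P$-equivariant map with $\Phi^*\omega'=\omega$) and every $\sigma\in\Gamma(WM')=C^\infty(\mathcal G',W)^P$, one has $\sigma\circ\Phi\in\Gamma(WM)$ and $(B\otimes\mathrm{id})D^2(\sigma\circ\Phi)=\big((B\otimes\mathrm{id})D^2\sigma\big)\circ\Phi$. -/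

import Mathlib

open scoped Manifold ContDiff

noncomputable section

namespace CurvedCasimir

/-! ### Calculus for maps into finite dimensional real vector spaces -/

section Calculus

variable {E : Type*} [NormedAddCommGroup E] [NormedSpace ℝ E] {H : Type*} [TopologicalSpace H]
  (I : ModelWithCorners ℝ E H) {N : Type*} [TopologicalSpace N] [ChartedSpace H N]
  {V : Type*} [AddCommGroup V] [Module ℝ V]

/-- A map from a manifold to a finite dimensional real vector space is smooth if all its
compositions with linear functionals are smooth. -/
def IsSmooth (f : N → V) : Prop :=
  ∀ ℓ : Module.Dual ℝ V, ContMDiff I 𝓘(ℝ, ℝ) ∞ (fun x => ℓ (f x))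

/-- The derivative at `x` of a map from a manifold to a finite dimensional real vector space,
computed in components with respect to a basis. -/
def vecDeriv [FiniteDimensional ℝ V] (f : N → V) (x : N) : TangentSpace I x →ₗ[ℝ] V :=
  ∑ i, LinearMap.smulRight
    (mvfderiv I (fun y => (Module.finBasis ℝ V).coord i (f y)) x).toLinearMap
    (Module.finBasis ℝ V i)

variable {I}

/-- The identification of the tangent spaces at two equal points. -/
def tcast {x y : N} (h : x = y) : TangentSpace I x ≃ₗ[ℝ] TangentSpace I y :=
  h ▸ LinearEquiv.refl ℝ (TangentSpace I x)

theorem tcast_mk {x y : N} (h : x = y) (v : TangentSpace I x) :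
    (⟨y, tcast h v⟩ : TangentBundle I N) = ⟨x, v⟩ := by
  subst h; rfl

theorem tcast_trans {x y z : N} (h : x = y) (h' : y = z) (v : TangentSpace I x) :
    tcast h' (tcast h v) = tcast (h.trans h') v := by
  subst h; subst h'; rfl

variable {E' : Type*} [NormedAddCommGroup E'] [NormedSpace ℝ E'] {H' : Type*}
  [TopologicalSpace H'] {I' : ModelWithCorners ℝ E' H'} {N' : Type*} [TopologicalSpace N']
  [ChartedSpace H' N']

theorem mfderiv_tcast (f : N → N') {x y : N} (h : x = y) (v : TangentSpace I x) :
    mfderiv I I' f y (tcast h v) = tcast (congrArg f h) (mfderiv I I' f x v) := by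
  subst h; rfl

theorem tcast_mfderiv_congr {f f' : N → N'} (e : f = f') {x : N} {y : N'} (h : f x = y)
    (v : TangentSpace I x) :
    tcast h (mfderiv I I' f x v) = tcast (by rw [← e, h] : f' x = y) (mfderiv I I' f' x v) := by
  subst e; rfl

end Calculus

/-! ### Lie groups and parabolic subgroups -/

section LieGroups

variable {n : ℕ} {G : Type*} [TopologicalSpace G] [ChartedSpace (EuclideanSpace ℝ (Fin n)) G]
  [Group G]

instance instLieGroupMinSmoothness [LieGroup (𝓡 n) ∞ G] :
    LieGroup (𝓡 n) (minSmoothness ℝ 3) G := by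
  rw [minSmoothness_of_isRCLikeNormedField]
  infer_instance

/-- The Lie algebra of the Lie group `G`. -/
abbrev 𝔤 (n : ℕ) (G : Type*) [TopologicalSpace G] [ChartedSpace (EuclideanSpace ℝ (Fin n)) G]
    [Group G] := GroupLieAlgebra (𝓡 n) G

instance instFiniteDimensionalLieAlgebra : FiniteDimensional ℝ (𝔤 n G) :=
  inferInstanceAs (FiniteDimensional ℝ (EuclideanSpace ℝ (Fin n)))

/-- The adjoint action of `g`: the derivative at `1` of the conjugation `x ↦ g x g⁻¹`. -/
def adMap (g : G) : 𝔤 n G →ₗ[ℝ] 𝔤 n G :=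
  (tcast (by simp : g * 1 * g⁻¹ = 1)).toLinearMap ∘ₗ
    (mfderiv (𝓡 n) (𝓡 n) (fun x : G => g * x * g⁻¹) 1).toLinearMap

theorem adMap_apply (g : G) (v : 𝔤 n G) :
    adMap g v = tcast (by simp : g * 1 * g⁻¹ = 1)
      (mfderiv (𝓡 n) (𝓡 n) (fun x : G => g * x * g⁻¹) 1 v) := rfl

theorem adMap_one : adMap (1 : G) = (LinearMap.id : 𝔤 n G →ₗ[ℝ] 𝔤 n G) := by
  apply LinearMap.ext
  intro v
  have h : (fun x : G => 1 * x * 1⁻¹) = id := by ext x; simp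
  rw [adMap_apply, tcast_mfderiv_congr h, mfderiv_id]
  rfl

variable [LieGroup (𝓡 n) ∞ G]

theorem mdifferentiableAt_mulLeft (g x : G) :
    MDifferentiableAt (𝓡 n) (𝓡 n) (fun y : G => g * y) x :=
  (contMDiff_mul_left (I := 𝓡 n) (n := ∞)).mdifferentiableAt (by simp)

theorem mdifferentiableAt_mulRight (g x : G) :
    MDifferentiableAt (𝓡 n) (𝓡 n) (fun y : G => y * g) x :=
  (contMDiff_mul_right (I := 𝓡 n) (n := ∞)).mdifferentiableAt (by simp)

theorem mdifferentiableAt_conj (g x : G) :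
    MDifferentiableAt (𝓡 n) (𝓡 n) (fun y : G => g * y * g⁻¹) x :=
  ((contMDiff_mul_right (I := 𝓡 n) (n := ∞)).comp
    (contMDiff_mul_left (I := 𝓡 n) (n := ∞))).mdifferentiableAt (by simp)

theorem adMap_mul (g h : G) : adMap (n := n) (g * h) = adMap g ∘ₗ adMap h := by
  have e : (fun x : G => g * h * x * (g * h)⁻¹)
      = (fun x => g * x * g⁻¹) ∘ (fun x => h * x * h⁻¹) := by
    ext x; simp [mul_assoc]
  apply LinearMap.ext
  intro v
  rw [LinearMap.comp_apply, adMap_apply, adMap_apply, adMap_apply, mfderiv_tcast, tcast_trans,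
    tcast_mfderiv_congr e,
    mfderiv_comp (I' := 𝓡 n) (1 : G) (mdifferentiableAt_conj g _) (mdifferentiableAt_conj h 1)]
  rfl

/-- The adjoint representation of `G` on its Lie algebra. -/
def Ad : Representation ℝ G (𝔤 n G) where
  toFun g := adMap g
  map_one' := adMap_one
  map_mul' := adMap_mul

/-- The Maurer-Cartan form: the derivative at `g` of left translation by `g⁻¹`. -/
def maurerCartan (g : G) : TangentSpace (𝓡 n) g ≃ₗ[ℝ] 𝔤 n G :=
  LinearEquiv.ofLinearMap
    ((tcast (by simp : g⁻¹ * g = 1)).toLinearMap ∘ₗ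
      (mfderiv (𝓡 n) (𝓡 n) (fun x : G => g⁻¹ * x) g).toLinearMap)
    ((tcast (by simp : g * 1 = g)).toLinearMap ∘ₗ
      (mfderiv (𝓡 n) (𝓡 n) (fun x : G => g * x) 1).toLinearMap)
    (by
      apply LinearMap.ext
      intro v
      have e : (fun x : G => g⁻¹ * x) ∘ (fun x => g * x) = id := by ext x; simp
      change tcast _ (mfderiv (𝓡 n) (𝓡 n) (fun x : G => g⁻¹ * x) g (tcast _
        (mfderiv (𝓡 n) (𝓡 n) (fun x : G => g * x) 1 v))) = v
      rw [mfderiv_tcast, tcast_trans]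
      have := tcast_mfderiv_congr (I := 𝓡 n) (I' := 𝓡 n) e (x := 1) (y := 1) (by simp) v
      rw [mfderiv_comp (I' := 𝓡 n) (1 : G) (mdifferentiableAt_mulLeft _ _)
        (mdifferentiableAt_mulLeft _ _), mfderiv_id] at this
      exact this)
    (by
      apply LinearMap.ext
      intro v
      have e : (fun x : G => g * x) ∘ (fun x => g⁻¹ * x) = id := by ext x; simp
      change tcast _ (mfderiv (𝓡 n) (𝓡 n) (fun x : G => g * x) 1 (tcast _
        (mfderiv (𝓡 n) (𝓡 n) (fun x : G => g⁻¹ * x) g v))) = v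
      rw [mfderiv_tcast, tcast_trans]
      have := tcast_mfderiv_congr (I := 𝓡 n) (I' := 𝓡 n) e (x := g) (y := g) (by simp) v
      rw [mfderiv_comp (I' := 𝓡 n) g (mdifferentiableAt_mulLeft _ _)
        (mdifferentiableAt_mulLeft _ _), mfderiv_id] at this
      exact this)

theorem maurerCartan_apply (g : G) (v : TangentSpace (𝓡 n) g) :
    maurerCartan g v = tcast (by simp : g⁻¹ * g = 1)
      (mfderiv (𝓡 n) (𝓡 n) (fun x : G => g⁻¹ * x) g v) := rfl

/-- A real Lie subalgebra is parabolic if its complexification contains a Borel subalgebra, that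
is, a maximal solvable subalgebra. -/
def IsParabolicSubalgebra {L : Type*} [LieRing L] [LieAlgebra ℝ L] (𝔭 : LieSubalgebra ℝ L) :
    Prop :=
  ∃ 𝔟 : LieSubalgebra ℂ (TensorProduct ℝ ℂ L),
    Maximal (fun 𝔠 : LieSubalgebra ℂ (TensorProduct ℝ ℂ L) => LieAlgebra.IsSolvable 𝔠) 𝔟 ∧
      𝔟.toSubmodule ≤ 𝔭.toSubmodule.baseChange ℂ

variable (P : Subgroup G)

/-- The adjoint representation of `G`, restricted to the subgroup `P`. -/
def AdRes : Representation ℝ P (𝔤 n G) := Ad.comp P.subtype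

variable {m : ℕ} [ChartedSpace (EuclideanSpace ℝ (Fin m)) P]

/-- The derivative at `1` of the inclusion of `P` into `G`, as a map from the Lie algebra of `P` to
the Lie algebra of `G`. -/
def inclDeriv : 𝔤 m P →ₗ[ℝ] 𝔤 n G :=
  (tcast P.coe_one).toLinearMap ∘ₗ
    (mfderiv (𝓡 m) (𝓡 n) (fun h : P => (h : G)) 1).toLinearMap

/-- `P` (with a given Lie group structure on it) is a closed, embedded Lie subgroup of `G` whose
Lie algebra is a parabolic subalgebra. -/
structure IsParabolicSubgroup (n m : ℕ) {G : Type*} [TopologicalSpace G]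
    [ChartedSpace (EuclideanSpace ℝ (Fin n)) G] [Group G] [LieGroup (𝓡 n) ∞ G]
    (P : Subgroup G) [ChartedSpace (EuclideanSpace ℝ (Fin m)) P] [LieGroup (𝓡 m) ∞ P] :
    Prop where
  isClosed : IsClosed (P : Set G)
  smooth_incl : ContMDiff (𝓡 m) (𝓡 n) ∞ (fun h : P => (h : G))
  injective_inclDeriv : Function.Injective (inclDeriv P : 𝔤 m P →ₗ[ℝ] 𝔤 n G)
  isParabolic : ∃ 𝔭 : LieSubalgebra ℝ (𝔤 n G),
    𝔭.toSubmodule = LinearMap.range (inclDeriv P : 𝔤 m P →ₗ[ℝ] 𝔤 n G) ∧ IsParabolicSubalgebra 𝔭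

end LieGroups

/-! ### Cartan geometries -/

section Cartan

variable (n m d : ℕ)
  {G : Type*} [TopologicalSpace G] [ChartedSpace (EuclideanSpace ℝ (Fin n)) G]
  [Group G] [LieGroup (𝓡 n) ∞ G]
  (P : Subgroup G) [ChartedSpace (EuclideanSpace ℝ (Fin m)) P]
  (𝒢 : Type*) [TopologicalSpace 𝒢] [ChartedSpace (EuclideanSpace ℝ (Fin n)) 𝒢]
  [IsManifold (𝓡 n) ∞ 𝒢]
  (M : Type*) [TopologicalSpace M] [ChartedSpace (EuclideanSpace ℝ (Fin d)) M]

/-- A manifold `𝒢` with a smooth right action of `P` and a Cartan connection: the total space of a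
Cartan geometry of type `(G, P)`. -/
structure CartanBundle where
  /-- the principal right action -/
  act : 𝒢 → P → 𝒢
  act_one : ∀ u, act u 1 = u
  act_mul : ∀ u h k, act u (h * k) = act (act u h) k
  smooth_act : ContMDiff ((𝓡 n).prod (𝓡 m)) (𝓡 n) ∞ (fun p : 𝒢 × P => act p.1 p.2)
  /-- the Cartan connection, an isomorphism from each tangent space of `𝒢` to the Lie algebra -/
  form : ∀ u : 𝒢, TangentSpace (𝓡 n) u ≃ₗ[ℝ] 𝔤 n G
  smooth_form : IsSmooth (𝓡 n).tangent (fun v : TangentBundle (𝓡 n) 𝒢 => form v.proj v.snd)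
  equivariant_form : ∀ (u : 𝒢) (h : P) (v : TangentSpace (𝓡 n) u),
    form (act u h) (mfderiv (𝓡 n) (𝓡 n) (fun x => act x h) u v) = AdRes P h⁻¹ (form u v)
  /-- the Cartan connection reproduces the generators of the fundamental vector fields; the value
  at `u` of the field generated by `A` is the derivative at `1` of `h ↦ u h` in direction `A` -/
  fundamental_form : ∀ (u : 𝒢) (A : 𝔤 m P),
    form (act u 1) (mfderiv (𝓡 m) (𝓡 n) (fun h : P => act u h) 1 A) = inclDeriv P A

/-- A Cartan geometry of type `(G, P)` on `M`: a smooth principal `P`-bundle `𝒢 → M` with a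
Cartan connection, where `dim M = dim G/P`. -/
structure CartanGeometry extends CartanBundle n m P 𝒢 where
  dim_eq : d + m = n
  /-- the bundle projection -/
  proj : 𝒢 → M
  smooth_proj : ContMDiff (𝓡 n) (𝓡 d) ∞ proj
  proj_act : ∀ u h, proj (act u h) = proj u
  /-- existence of smooth `P`-equivariant local trivializations -/
  locallyTrivial : ∀ x : M, ∃ (U : Set M)
    (e : PartialDiffeomorph (𝓡 n) ((𝓡 d).prod (𝓡 m)) 𝒢 (M × P) ∞),
    x ∈ U ∧ e.source = proj ⁻¹' U ∧ e.target = U ×ˢ Set.univ ∧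
    (∀ u ∈ e.source, (e u).1 = proj u) ∧
    ∀ u ∈ e.source, ∀ h : P, e (act u h) = ((e u).1, (e u).2 * h)

variable {n m d P 𝒢 M}

/-- The smooth sections of the natural bundle `𝒢 ×_P V`, viewed as smooth equivariant functions
`𝒢 → V`. -/
def CartanBundle.sections (X : CartanBundle n m P 𝒢) {V : Type*} [AddCommGroup V] [Module ℝ V]
    (ρ : Representation ℝ P V) : Submodule ℝ (𝒢 → V) where
  carrier := {f | IsSmooth (𝓡 n) f ∧ ∀ u h, f (X.act u h) = ρ h⁻¹ (f u)}
  add_mem' := by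
    rintro f g ⟨hf, hf'⟩ ⟨hg, hg'⟩
    refine ⟨fun ℓ => ?_, fun u h => by simp [hf', hg']⟩
    simp only [Pi.add_apply, map_add]
    exact (hf ℓ).add (hg ℓ)
  zero_mem' := ⟨fun ℓ => by simpa using contMDiff_const, fun u h => by simp⟩
  smul_mem' := by
    rintro c f ⟨hf, hf'⟩
    refine ⟨fun ℓ => ?_, fun u h => by simp [hf']⟩
    simp only [Pi.smul_apply, map_smul, smul_eq_mul]
    exact contMDiff_const.mul (hf ℓ)

section Operators

variable (X : CartanBundle n m P 𝒢) {V : Type*} [AddCommGroup V] [Module ℝ V]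
  [FiniteDimensional ℝ V]

/-- The representation of `P` inducing the bundle `𝒜*M ⊗ VM = Hom(𝒜M, VM)`, where `𝒜M` is the
adjoint tractor bundle. -/
abbrev coadjointTwist (ρ : Representation ℝ P V) : Representation ℝ P (𝔤 n G →ₗ[ℝ] V) :=
  Representation.linHom (AdRes P) ρ

/-- The fundamental derivative, as an operator from sections of `VM` to sections of
`𝒜*M ⊗ VM`. -/
def fundDeriv (f : 𝒢 → V) : 𝒢 → (𝔤 n G →ₗ[ℝ] V) :=
  fun u => vecDeriv (𝓡 n) f u ∘ₗ (X.form u).symm.toLinearMap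

end Operators

end Cartan

section HomogeneousModel

variable {n m : ℕ}
  {G : Type*} [TopologicalSpace G] [ChartedSpace (EuclideanSpace ℝ (Fin n)) G]
  [Group G] [LieGroup (𝓡 n) ∞ G]
  (P : Subgroup G) [ChartedSpace (EuclideanSpace ℝ (Fin m)) P]

theorem isSmooth_maurerCartan :
    IsSmooth (𝓡 n).tangent (fun v : TangentBundle (𝓡 n) G => maurerCartan v.proj v.snd) := by
  intro ℓ
  -- the map `v ↦ (0_{g⁻¹}, v) ↦ T(mul)(0_{g⁻¹}, v)`, which has values in the fibre over `1`
  let F₁ : TangentBundle (𝓡 n) G → TangentBundle (𝓡 n) G × TangentBundle (𝓡 n) G :=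
    fun v => (⟨v.proj⁻¹, 0⟩, v)
  have S₁ : ContMDiff (𝓡 n).tangent ((𝓡 n).tangent.prod (𝓡 n).tangent) ∞ F₁ := by
    refine ContMDiff.prodMk ?_ contMDiff_id
    exact (Bundle.contMDiff_zeroSection ℝ (TangentSpace (𝓡 n) (M := G))).comp
      ((contMDiff_inv (𝓡 n) ∞).comp (Bundle.contMDiff_proj (TangentSpace (𝓡 n) (M := G))))
  let F₂ := (equivTangentBundleProd (𝓡 n) G (𝓡 n) G).symm
  have S₂ : ContMDiff ((𝓡 n).tangent.prod (𝓡 n).tangent) ((𝓡 n).prod (𝓡 n)).tangent ∞ F₂ :=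
    contMDiff_equivTangentBundleProd_symm
  let F₃ := tangentMap ((𝓡 n).prod (𝓡 n)) (𝓡 n) (fun p : G × G => p.1 * p.2)
  have S₃ : ContMDiff ((𝓡 n).prod (𝓡 n)).tangent (𝓡 n).tangent ∞ F₃ :=
    ContMDiff.contMDiff_tangentMap (n := ∞) (contMDiff_mul (𝓡 n) ∞) (by simp)
  have S := (S₃.comp S₂).comp S₁
  have hS : ∀ v, ((F₃ ∘ F₂) ∘ F₁) v
      = (⟨1, maurerCartan v.proj v.snd⟩ : TangentBundle (𝓡 n) G) := by
    intro v
    rw [maurerCartan_apply, tcast_mk]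
    have key := mfderiv_prod_eq_add_apply (I := 𝓡 n) (I' := 𝓡 n) (I'' := 𝓡 n)
      (f := fun p : G × G => p.1 * p.2) (p := (v.proj⁻¹, v.proj))
      (v := ((0 : TangentSpace (𝓡 n) v.proj⁻¹), v.snd))
      ((contMDiff_mul (𝓡 n) ∞).mdifferentiableAt (by simp))
    have key' := key.trans (congrArg (· + _) (map_zero _))
    exact congrArg (Bundle.TotalSpace.mk (v.proj⁻¹ * v.proj)) (key'.trans (zero_add _))
  have hS' : ContMDiff (𝓡 n).tangent (𝓡 n).tangent ∞
      (fun v : TangentBundle (𝓡 n) G => (⟨1, maurerCartan v.proj v.snd⟩ : TangentBundle (𝓡 n) G)) := by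
    rw [← funext hS]; exact S
  let e := trivializationAt (EuclideanSpace ℝ (Fin n)) (TangentSpace (𝓡 n) (M := G)) 1
  have he : (1 : G) ∈ e.baseSet :=
    FiberBundle.mem_baseSet_trivializationAt' (F := EuclideanSpace ℝ (Fin n))
      (E := TangentSpace (𝓡 n) (M := G)) 1
  let L := e.continuousLinearEquivAt ℝ 1 he
  let ℓ' : EuclideanSpace ℝ (Fin n) →L[ℝ] ℝ :=
    LinearMap.toContinuousLinearMap (ℓ ∘ₗ L.symm.toLinearEquiv.toLinearMap)
  intro v₀
  have h₁ : ContMDiffAt (𝓡 n).tangent 𝓘(ℝ, EuclideanSpace ℝ (Fin n)) ∞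
      (fun v : TangentBundle (𝓡 n) G => L (maurerCartan v.proj v.snd)) v₀ :=
    (Bundle.contMDiffAt_totalSpace.1 (hS' v₀)).2
  have h₂ := ℓ'.contMDiff.contMDiffAt.comp v₀ h₁
  refine h₂.congr_of_eventuallyEq (Filter.Eventually.of_forall fun v => ?_)
  change _ = ℓ (L.symm (L _))
  rw [L.symm_apply_apply]

variable [LieGroup (𝓡 m) ∞ P]

/-- The homogeneous model: the group `G` with the right action of `P` by multiplication and the
left Maurer-Cartan form. -/
def homogeneousModel (hP : IsParabolicSubgroup n m P) : CartanBundle n m P G where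
  act u h := u * h
  act_one u := by simp
  act_mul u h k := by simp [mul_assoc]
  smooth_act := (contMDiff_mul (𝓡 n) ∞).comp
    (contMDiff_fst.prodMk (hP.smooth_incl.comp contMDiff_snd))
  form g := maurerCartan g
  smooth_form := isSmooth_maurerCartan
  equivariant_form u h v := by
    have e : (fun x : G => (u * h)⁻¹ * x) ∘ (fun x => x * h)
        = (fun x => (h : G)⁻¹ * x * (h : G)⁻¹⁻¹) ∘ (fun x => u⁻¹ * x) := by
      ext x; simp [mul_assoc]
    have := tcast_mfderiv_congr (I := 𝓡 n) (I' := 𝓡 n) e (x := u) (y := 1) (by simp) v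
    rw [mfderiv_comp (I' := 𝓡 n) u (mdifferentiableAt_mulLeft _ _)
        (mdifferentiableAt_mulRight _ _), mfderiv_comp (I' := 𝓡 n) u (mdifferentiableAt_conj _ _)
        (mdifferentiableAt_mulLeft _ _)] at this
    rw [maurerCartan_apply, maurerCartan_apply]
    change _ = adMap ((h : G)⁻¹) _
    rw [adMap_apply, mfderiv_tcast, tcast_trans]
    exact this
  fundamental_form u A := by
    have e : (fun x : G => (u * ((1 : P) : G))⁻¹ * x) ∘ (fun h : P => u * h)
        = (fun h : P => (h : G)) := by
      ext x; simp
    have hd : MDifferentiableAt (𝓡 m) (𝓡 n) (fun h : P => (h : G)) 1 :=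
      hP.smooth_incl.mdifferentiableAt (by simp)
    have hd' : MDifferentiableAt (𝓡 m) (𝓡 n) (fun h : P => u * (h : G)) 1 :=
      (mdifferentiableAt_mulLeft u _).comp (1 : P) hd
    have := tcast_mfderiv_congr (I := 𝓡 m) (I' := 𝓡 n) e (x := 1) (y := 1) (by simp) A
    rw [mfderiv_comp (I' := 𝓡 n) (1 : P) (mdifferentiableAt_mulLeft _ _) hd'] at this
    rw [maurerCartan_apply]
    exact this

end HomogeneousModel

/-! ### The Casimir operator and the curved Casimir operator -/

section Casimir

variable {n m d : ℕ}
  {G : Type*} [TopologicalSpace G] [ChartedSpace (EuclideanSpace ℝ (Fin n)) G]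
  [Group G] [LieGroup (𝓡 n) ∞ G]
  {V : Type*} [AddCommGroup V] [Module ℝ V] [FiniteDimensional ℝ V]

/-- The Killing form of the Lie algebra of `G`. -/
abbrev killing (n : ℕ) (G : Type*) [TopologicalSpace G]
    [ChartedSpace (EuclideanSpace ℝ (Fin n)) G] [Group G] [LieGroup (𝓡 n) ∞ G] :
    LinearMap.BilinForm ℝ (𝔤 n G) := killingForm ℝ (𝔤 n G)

/-- The infinitesimal action of `X` on functions on `G`, i.e. the derivative at `1` in direction `X`
of `a ↦ a · f`, where `(a · f)(g) = f (a⁻¹ g)`. -/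
def lieAction (X : 𝔤 n G) (f : G → V) : G → V :=
  fun g => vecDeriv (𝓡 n) (fun a : G => f (a⁻¹ * g)) 1 X

variable [LieAlgebra.IsSemisimple ℝ (𝔤 n G)]

theorem killing_nondegenerate : (killing n G).Nondegenerate :=
  LieAlgebra.IsKilling.killingForm_nondegenerate ℝ (𝔤 n G)

/-- The basis dual to `ξ` with respect to the Killing form. -/
def killingDual {ι : Type*} [Finite ι] [DecidableEq ι] (ξ : Module.Basis ι ℝ (𝔤 n G)) :
    Module.Basis ι ℝ (𝔤 n G) :=
  (killing n G).dualBasis killing_nondegenerate ξ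

/-- The Casimir operator `∑ ξˡ · ξₗ · f` of the action of `G` on functions on `G`. -/
def casimir {ι : Type*} [Fintype ι] [DecidableEq ι] (ξ : Module.Basis ι ℝ (𝔤 n G))
    (f : G → V) : G → V :=
  ∑ i, lieAction (ξ i) (lieAction (killingDual ξ i) f)

variable (n G) in
/-- The element of `𝔤 ⊗ 𝔤` corresponding to the Killing form via the isomorphism `𝔤* ≅ 𝔤` which the
Killing form induces: the image of the identity of `𝔤` under `End 𝔤 = 𝔤* ⊗ 𝔤 ≅ 𝔤 ⊗ 𝔤`. -/
def killingTensor : TensorProduct ℝ (𝔤 n G) (𝔤 n G) :=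
  TensorProduct.map ((killing n G).toDual killing_nondegenerate).symm.toLinearMap LinearMap.id
    ((dualTensorHomEquiv ℝ (𝔤 n G) (𝔤 n G)).symm LinearMap.id)

/-- The contraction `B ⊗ id : 𝔤* ⊗ 𝔤* ⊗ V → V` with the Killing form. -/
def killingContraction : (𝔤 n G →ₗ[ℝ] 𝔤 n G →ₗ[ℝ] V) →ₗ[ℝ] V where
  toFun Φ := TensorProduct.lift Φ (killingTensor n G)
  map_add' Φ Ψ := by
    have : TensorProduct.lift (Φ + Ψ) = TensorProduct.lift Φ + TensorProduct.lift Ψ :=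
      TensorProduct.ext' fun x y => by simp
    rw [this, LinearMap.add_apply]
  map_smul' c Φ := by
    have : TensorProduct.lift (c • Φ) = c • TensorProduct.lift Φ :=
      TensorProduct.ext' fun x y => by simp
    rw [this, LinearMap.smul_apply, RingHom.id_apply]

variable {P : Subgroup G} [ChartedSpace (EuclideanSpace ℝ (Fin m)) P]
  {𝒢 : Type*} [TopologicalSpace 𝒢] [ChartedSpace (EuclideanSpace ℝ (Fin n)) 𝒢]
  [IsManifold (𝓡 n) ∞ 𝒢]

/-- The composition `(B ⊗ id) ∘ D²`. -/
def curvedCasimir (X : CartanBundle n m P 𝒢) (f : 𝒢 → V) : 𝒢 → V :=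
  fun u => killingContraction (fundDeriv X (fundDeriv X f) u)

end Casimir

/-! ### Invariant differential operators -/

section InvariantOperators

variable {n m d : ℕ}
  {G : Type*} [TopologicalSpace G] [ChartedSpace (EuclideanSpace ℝ (Fin n)) G]
  [Group G] [LieGroup (𝓡 n) ∞ G]
  {P : Subgroup G} [ChartedSpace (EuclideanSpace ℝ (Fin m)) P]
  {𝒢 : Type*} [TopologicalSpace 𝒢] [ChartedSpace (EuclideanSpace ℝ (Fin n)) 𝒢]
  [IsManifold (𝓡 n) ∞ 𝒢]
  {M : Type*} [TopologicalSpace M] [ChartedSpace (EuclideanSpace ℝ (Fin d)) M]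
  {V : Type*} [AddCommGroup V] [Module ℝ V]

/-- Multiplication of sections of the natural bundle induced by `V` by a smooth function on the
base manifold. -/
def CartanGeometry.mulOp (Y : CartanGeometry n m d P 𝒢 M) (ρ : Representation ℝ P V)
    (φ : C^∞⟮𝓡 d, M; 𝓘(ℝ, ℝ), ℝ⟯) : Y.sections ρ →ₗ[ℝ] Y.sections ρ where
  toFun σ := ⟨fun u => φ (Y.proj u) • σ.1 u, by
    refine ⟨fun ℓ => ?_, fun u h => ?_⟩
    · simp only [map_smul, smul_eq_mul]
      exact (φ.contMDiff.comp Y.smooth_proj).mul (σ.2.1 ℓ)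
    · simp only [Y.proj_act, σ.2.2 u h, map_smul]⟩
  map_add' σ τ := by
    ext u
    simp
  map_smul' c σ := by
    ext u
    simp only [Submodule.coe_smul, Pi.smul_apply, RingHom.id_apply]
    exact smul_comm _ _ _

/-- A linear operator on sections is a differential operator of order at most `k` if all its
`(k+1)`-fold iterated commutators with multiplications by smooth functions on `M` vanish. -/
def CartanGeometry.IsDifferentialOperator (Y : CartanGeometry n m d P 𝒢 M)
    (ρ : Representation ℝ P V) : ℕ → (Y.sections ρ →ₗ[ℝ] Y.sections ρ) → Prop
  | 0, L => ∀ φ, L ∘ₗ Y.mulOp ρ φ - Y.mulOp ρ φ ∘ₗ L = 0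
  | k + 1, L => ∀ φ, Y.IsDifferentialOperator ρ k (L ∘ₗ Y.mulOp ρ φ - Y.mulOp ρ φ ∘ₗ L)

variable {𝒢' : Type*} [TopologicalSpace 𝒢'] [ChartedSpace (EuclideanSpace ℝ (Fin n)) 𝒢']
  [IsManifold (𝓡 n) ∞ 𝒢']

/-- A morphism of Cartan geometries: a smooth `P`-equivariant map of the total spaces that pulls
back one Cartan connection to the other. -/
structure CartanMorphism (X : CartanBundle n m P 𝒢) (X' : CartanBundle n m P 𝒢') where
  /-- the underlying map -/
  toFun : 𝒢 → 𝒢'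
  smooth : ContMDiff (𝓡 n) (𝓡 n) ∞ toFun
  map_act : ∀ u h, toFun (X.act u h) = X'.act (toFun u) h
  pullback_form : ∀ (u : 𝒢) (v : TangentSpace (𝓡 n) u),
    X'.form (toFun u) (mfderiv (𝓡 n) (𝓡 n) toFun u v) = X.form u v

end InvariantOperators

end CurvedCasimir

end

noncomputable section

namespace CurvedCasimir

/-! ### Weak smoothness, derivatives tested on functionals, symmetry of mixed partial derivatives -/

section SmoothMaps

variable {E : Type*} [NormedAddCommGroup E] [NormedSpace ℝ E] {H : Type*} [TopologicalSpace H]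
  {I : ModelWithCorners ℝ E H} {N : Type*} [TopologicalSpace N] [ChartedSpace H N]
  {E' : Type*} [NormedAddCommGroup E'] [NormedSpace ℝ E'] {H' : Type*} [TopologicalSpace H']
  {I' : ModelWithCorners ℝ E' H'} {N' : Type*} [TopologicalSpace N'] [ChartedSpace H' N']
  {U : Type*} [AddCommGroup U] [Module ℝ U] {V : Type*} [AddCommGroup V] [Module ℝ V]

/-! A Cartan connection parallelizes `𝒢`: each `A` in the Lie algebra gives the vector field
`ω⁻¹(A)`, and the fundamental derivative is differentiation along these fields. Pairing with a
functional `ℓ` turns `D²f (A) (B)` into the iterated derivative of the scalar function `ℓ ∘ f` along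
`B`, then along `A` (`dual_fundDeriv_fundDeriv`). Hence the curved Casimir operator becomes a sum of
products of two such derivations (`dual_curvedCasimir`).

From this description, the Leibniz rule shows that triple commutators with functions vanish. A
morphism maps each field `ω⁻¹(A)` to its counterpart, which gives invariance (`frameDeriv_comp`).
The result is again a section because `ω` is equivariant and the Killing tensor is invariant under
`Ad` (`fundDeriv_mem_sections`, `killingContraction_coadjointTwist`).

On `G` the fields `ω⁻¹(A)` are left invariant. At `g`, the infinitesimal action of `X` is minus the
derivative along the left invariant field of `Ad(g⁻¹)X`. Left translations commute with left
invariant fields, so `X · Y · f` at `g` is `D²f` evaluated on `Ad(g⁻¹)Y`, `Ad(g⁻¹)X`: the two signs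
cancel and the order is reversed (`lieAction_lieAction`). Summing over dual bases, `Ad`-invariance
of the Killing tensor removes the `Ad(g⁻¹)`. -/

theorem eq_of_forall_dual {v w : V} (h : ∀ ℓ : Module.Dual ℝ V, ℓ v = ℓ w) : v = w :=
  sub_eq_zero.1 <| (Module.forall_dual_apply_eq_zero_iff ℝ _).1 fun ℓ => by
    rw [map_sub, h, sub_self]

theorem IsSmooth.linearMap_comp {f : N → V} (hf : IsSmooth I f) (T : V →ₗ[ℝ] U) :
    IsSmooth I fun x => T (f x) :=
  fun ℓ => hf (ℓ ∘ₗ T)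

theorem IsSmooth.comp_contMDiff {f : N' → V} (hf : IsSmooth I' f) {Φ : N → N'}
    (hΦ : ContMDiff I I' ∞ Φ) : IsSmooth I (f ∘ Φ) :=
  fun ℓ => (hf ℓ).comp hΦ

/-- Any linear map is the sum of `b.coord i ⊗ F x (b i)` over a finite basis `b` of `U`, so a
functional of `F x` is a finite sum of functionals of its values. -/
theorem isSmooth_of_apply [FiniteDimensional ℝ U] {F : N → U →ₗ[ℝ] V}
    (h : ∀ X, IsSmooth I fun x => F x X) : IsSmooth I F := by
  intro ℓ
  let b := Module.finBasis ℝ U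
  have e : (fun x => ℓ (F x))
      = fun x => ∑ i, (ℓ ∘ₗ LinearMap.smulRightₗ (b.coord i)) (F x (b i)) := by
    funext x
    simp only [LinearMap.comp_apply]
    rw [← map_sum]
    congr 1
    refine b.ext fun j => ?_
    simp [LinearMap.sum_apply, Finsupp.single_apply, ite_smul]
  rw [e]
  exact ContMDiff.sum fun i _ => h (b i) _

theorem mvfderiv_finset_sum {ι : Type} (s : Finset ι) {f : ι → N → ℝ} {x : N}
    (hf : ∀ i ∈ s, MDifferentiableAt I 𝓘(ℝ, ℝ) (f i) x) :
    mvfderiv I (fun y => ∑ i ∈ s, f i y) x = ∑ i ∈ s, mvfderiv I (f i) x := by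
  classical
  induction s using Finset.induction_on with
  | empty => simp [mvfderiv_const]
  | insert a s ha ih =>
    have hs := fun i hi => hf i (Finset.mem_insert_of_mem hi)
    have e : (∑ i ∈ s, f i) = fun y => ∑ i ∈ s, f i y := by
      ext y
      simp
    have hd : MDifferentiableAt I 𝓘(ℝ, ℝ) (fun y => ∑ i ∈ s, f i y) x :=
      e ▸ MDifferentiableAt.sum hs
    simp only [Finset.sum_insert ha]
    rw [mvfderiv_fun_add (hf a (Finset.mem_insert_self a s)) hd, ih hs]

/-- Frees `vecDeriv` from the basis in its definition and reduces vector valued derivatives to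
scalar ones. -/
theorem dual_vecDeriv [FiniteDimensional ℝ V] {f : N → V} (hf : IsSmooth I f)
    (ℓ : Module.Dual ℝ V) (x : N) (v : TangentSpace I x) :
    ℓ (vecDeriv I f x v) = mvfderiv I (fun y => ℓ (f y)) x v := by
  let b := Module.finBasis ℝ V
  have e : (fun y => ℓ (f y)) = fun y => ∑ i, ((ℓ (b i)) • b.coord i) (f y) := by
    funext y
    conv_lhs => rw [← b.sum_repr (f y)]
    simp [mul_comm, -Module.Basis.sum_repr]
  rw [e, mvfderiv_finset_sum _ fun i _ => (hf _).mdifferentiableAt (by simp)]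
  simp only [vecDeriv, LinearMap.sum_apply, _root_.sum_apply, map_sum]
  refine Finset.sum_congr rfl fun i _ => ?_
  have hd : MDifferentiableAt I 𝓘(ℝ, ℝ) (fun y => b.coord i (f y)) x :=
    (hf _).mdifferentiableAt (by simp)
  have := mvfderiv_fun_smul (mdifferentiableAt_const (c := ℓ (b i)) (I := I) (x := x)) hd
  simp only [LinearMap.smul_apply]
  rw [this]
  simp [mvfderiv_const, b, mul_comm]

/-- The derivative is the fibre coordinate of the smooth tangent map of `φ` in the trivial tangent
bundle of `ℝ`. -/
theorem contMDiff_of_contMDiff_tangentMap_snd {Q : Type*} [TopologicalSpace Q] {E₀ H₀ : Type*}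
    [NormedAddCommGroup E₀] [NormedSpace ℝ E₀] [TopologicalSpace H₀] [ChartedSpace H₀ Q]
    {I₀ : ModelWithCorners ℝ E₀ H₀} [IsManifold I ∞ N]
    {φ : N → ℝ} (hφ : ContMDiff I 𝓘(ℝ, ℝ) ∞ φ) {s : Q → TangentBundle I N}
    (hs : ContMDiff I₀ I.tangent ∞ s) :
    ContMDiff I₀ 𝓘(ℝ, ℝ) ∞ fun q => mvfderiv I φ (s q).proj (s q).2 := by
  have h := (ContMDiff.contMDiff_tangentMap (n := ∞) (m := ∞) hφ (by simp)).comp hs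
  intro q
  have := (Bundle.contMDiffAt_totalSpace.1 (h q)).2
  refine this.congr_of_eventuallyEq (Filter.Eventually.of_forall fun q => ?_)
  simp [tangentMap, mvfderiv]
  rfl

theorem mvfderiv_comp_slice {F : N × N' → ℝ} (hF : ContMDiff (I.prod I') 𝓘(ℝ, ℝ) ∞ F)
    (x : N) (y : N') (v : TangentSpace I x) :
    mvfderiv I (fun x => F (x, y)) x v
      = mvfderiv (I.prod I') F (x, y) ((v, 0) : TangentSpace (I.prod I') (x, y)) := by
  have h := mvfderiv_comp_apply (I := I.prod I') (I' := I) (f := fun x : N => (x, y)) (g := F) x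
    (hF.mdifferentiableAt (by simp)) (mdifferentiableAt_id.prodMk mdifferentiableAt_const) v
  rw [mfderiv_prod_left] at h
  exact h

/-- A partial derivative is the full derivative of `F` along `(v, 0)`, and this tangent vector at
`(x, y)` depends smoothly on `y`. -/
theorem contMDiff_mvfderiv_slice [IsManifold I ∞ N] [IsManifold I' ∞ N']
    {F : N × N' → ℝ} (hF : ContMDiff (I.prod I') 𝓘(ℝ, ℝ) ∞ F) (x : N) (v : TangentSpace I x) :
    ContMDiff I' 𝓘(ℝ, ℝ) ∞ fun y => mvfderiv I (fun x => F (x, y)) x v := by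
  have h₁ : ContMDiff I' (I.tangent.prod I'.tangent) ∞
      (fun y => ((⟨x, v⟩, ⟨y, 0⟩) : TangentBundle I N × TangentBundle I' N')) :=
    contMDiff_const.prodMk (Bundle.contMDiff_zeroSection ℝ (TangentSpace I' (M := N')))
  have h₂ : ContMDiff (I.tangent.prod I'.tangent) (I.prod I').tangent ∞
      (equivTangentBundleProd I N I' N').symm := contMDiff_equivTangentBundleProd_symm
  have h := contMDiff_of_contMDiff_tangentMap_snd hF (h₂.comp h₁)
  refine h.congr fun y => ?_
  exact mvfderiv_comp_slice hF x y v

/-- Both sides are the second derivative of `F` on the vectors `(v, 0)` and `(0, w)`, which is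
symmetric. -/
theorem fderiv_fderiv_slice_comm {F : E × E' → ℝ} {a : E} {b : E'} (hF : ContDiffAt ℝ 2 F (a, b))
    (v : E) (w : E') :
    fderiv ℝ (fun x => fderiv ℝ (fun y => F (x, y)) b w) a v
      = fderiv ℝ (fun y => fderiv ℝ (fun x => F (x, y)) a v) b w := by
  have hev : ∀ᶠ p in nhds (a, b), DifferentiableAt ℝ F p :=
    (hF.eventually (by simp)).mono fun p hp => hp.differentiableAt (by simp)
  have hd : DifferentiableAt ℝ (fderiv ℝ F) (a, b) :=
    (hF.fderiv_right (m := 1) (by norm_num)).differentiableAt (by simp)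
  have hl : HasFDerivAt (fun x : E => (x, b)) (ContinuousLinearMap.inl ℝ E E') a :=
    hasFDerivAt_prodMk_left a b
  have hr : HasFDerivAt (fun y : E' => (a, y)) (ContinuousLinearMap.inr ℝ E E') b :=
    hasFDerivAt_prodMk_right a b
  have e₁ : (fun x => fderiv ℝ (fun y => F (x, y)) b w) =ᶠ[nhds a]
      fun x => fderiv ℝ F (x, b) (0, w) := by
    filter_upwards [hl.continuousAt.eventually hev] with x hx
    have h := HasFDerivAt.comp b hx.hasFDerivAt (hasFDerivAt_prodMk_right x b)
    exact congrArg (fun L => L w) h.fderiv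
  have e₂ : (fun y => fderiv ℝ (fun x => F (x, y)) a v) =ᶠ[nhds b]
      fun y => fderiv ℝ F (a, y) (v, 0) := by
    filter_upwards [hr.continuousAt.eventually hev] with y hy
    have h := HasFDerivAt.comp a (f := fun x : E => (x, y)) hy.hasFDerivAt
      (hasFDerivAt_prodMk_left a y)
    exact congrArg (fun L => L v) h.fderiv
  rw [e₁.fderiv_eq, e₂.fderiv_eq]
  have h₁ := ((hd.hasFDerivAt.comp a hl).clm_apply (hasFDerivAt_const ((0 : E), w) a)).fderiv
  have h₂ := ((hd.hasFDerivAt.comp b hr).clm_apply (hasFDerivAt_const (v, (0 : E')) b)).fderiv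
  simp only [Function.comp_apply] at h₁ h₂
  rw [h₁, h₂]
  simpa using hF.isSymmSndFDerivAt (by simp) (v, 0) (0, w)

theorem mvfderiv_eq_fderiv [I.Boundaryless] {φ : N → ℝ} {x : N}
    (hφ : MDifferentiableAt I 𝓘(ℝ, ℝ) φ x) (v : E) :
    mvfderiv I φ x v = fderiv ℝ (φ ∘ (extChartAt I x).symm) (extChartAt I x x) v := by
  have := hφ.mvfderiv
  rw [I.range_eq_univ, fderivWithin_univ] at this
  exact congrArg (fun L => L v) this

/-- Each inner derivative stays at one fixed point of its factor, so the charts at `x` and `y`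
suffice and the claim becomes the one in vector spaces. -/
theorem mvfderiv_mvfderiv_comm [I.Boundaryless] [I'.Boundaryless] [IsManifold I ∞ N]
    [IsManifold I' ∞ N']
    {F : N × N' → ℝ} (hF : ContMDiff (I.prod I') 𝓘(ℝ, ℝ) ∞ F) (x : N) (y : N')
    (v : TangentSpace I x) (w : TangentSpace I' y) :
    mvfderiv I (fun x => mvfderiv I' (fun y => F (x, y)) y w) x v
      = mvfderiv I' (fun y => mvfderiv I (fun x => F (x, y)) x v) y w := by
  have hsw : ContMDiff (I'.prod I) 𝓘(ℝ, ℝ) ∞ fun p : N' × N => F (p.2, p.1) :=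
    hF.comp (contMDiff_snd.prodMk contMDiff_fst)
  have h₁ (x : N) : MDifferentiableAt I' 𝓘(ℝ, ℝ) (fun y => F (x, y)) y :=
    (hF.comp (contMDiff_const.prodMk contMDiff_id)).mdifferentiableAt (by simp)
  have h₂ (y : N') : MDifferentiableAt I 𝓘(ℝ, ℝ) (fun x => F (x, y)) x :=
    (hF.comp (contMDiff_id.prodMk contMDiff_const)).mdifferentiableAt (by simp)
  have g₁ : MDifferentiableAt I 𝓘(ℝ, ℝ) (fun x => mvfderiv I' (fun y => F (x, y)) y w) x :=
    (contMDiff_mvfderiv_slice hsw y w).mdifferentiableAt (by simp)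
  have g₂ : MDifferentiableAt I' 𝓘(ℝ, ℝ) (fun y => mvfderiv I (fun x => F (x, y)) x v) y :=
    (contMDiff_mvfderiv_slice hF x v).mdifferentiableAt (by simp)
  refine (mvfderiv_eq_fderiv g₁ v).trans (Eq.trans ?_ (mvfderiv_eq_fderiv g₂ w).symm)
  have e₁ : (fun x' => mvfderiv I' (fun y => F (x', y)) y w) = fun x' =>
      fderiv ℝ ((fun y => F (x', y)) ∘ (extChartAt I' y).symm) (extChartAt I' y y) w :=
    funext fun x' => mvfderiv_eq_fderiv (h₁ x') w
  have e₂ : (fun y' => mvfderiv I (fun x => F (x, y')) x v) = fun y' =>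
      fderiv ℝ ((fun x => F (x, y')) ∘ (extChartAt I x).symm) (extChartAt I x x) v :=
    funext fun y' => mvfderiv_eq_fderiv (h₂ y') v
  rw [e₁, e₂]
  have hs₁ : ContMDiffAt 𝓘(ℝ, E) I ∞ (extChartAt I x).symm (extChartAt I x x) :=
    (contMDiffOn_extChartAt_symm x).contMDiffAt (extChartAt_target_mem_nhds x)
  have hs₂ : ContMDiffAt 𝓘(ℝ, E') I' ∞ (extChartAt I' y).symm (extChartAt I' y y) :=
    (contMDiffOn_extChartAt_symm y).contMDiffAt (extChartAt_target_mem_nhds y)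
  have hs : ContMDiffAt 𝓘(ℝ, E × E') 𝓘(ℝ, ℝ) ∞
      (fun p : E × E' => F ((extChartAt I x).symm p.1, (extChartAt I' y).symm p.2))
      (extChartAt I x x, extChartAt I' y y) := by
    refine hF.contMDiffAt.comp _ (ContMDiffAt.prodMk ?_ ?_)
    · exact hs₁.comp (_ : E × E') contDiffAt_fst.contMDiffAt
    · exact hs₂.comp (_ : E × E') contDiffAt_snd.contMDiffAt
  exact fderiv_fderiv_slice_comm (hs.contDiffAt.of_le ENat.LEInfty.out) v w


end SmoothMaps

/-! ### Smoothness of the vector fields dual to a smooth coframe -/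

section FrameFields

variable {E : Type*} [NormedAddCommGroup E] [NormedSpace ℝ E] {H : Type*} [TopologicalSpace H]
  {I : ModelWithCorners ℝ E H} {N : Type*} [TopologicalSpace N] [ChartedSpace H N]
  {F : Type*} [NormedAddCommGroup F] [NormedSpace ℝ F] [FiniteDimensional ℝ F]
  {F' : Type*} [NormedAddCommGroup F'] [NormedSpace ℝ F']

theorem contMDiffAt_of_dual {f : N → F} {x : N}
    (h : ∀ ℓ : Module.Dual ℝ F, ContMDiffAt I 𝓘(ℝ, ℝ) ∞ (fun y => ℓ (f y)) x) :
    ContMDiffAt I 𝓘(ℝ, F) ∞ f x := by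
  let b := Module.finBasis ℝ F
  have e : f = fun y => ∑ i, b.coord i (f y) • b i :=
    funext fun y => (b.sum_repr (f y)).symm
  rw [e]
  exact ContMDiffAt.sum fun i _ => (h (b.coord i)).smul contMDiffAt_const

theorem contMDiffAt_clm_of_apply {B : N → F →L[ℝ] F'} {x : N}
    (h : ∀ v, ContMDiffAt I 𝓘(ℝ, F') ∞ (fun y => B y v) x) :
    ContMDiffAt I 𝓘(ℝ, F →L[ℝ] F') ∞ B x := by
  let b := Module.finBasis ℝ F
  let c := fun i => LinearMap.toContinuousLinearMap (b.coord i)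
  have e : B = fun y => ∑ i, ContinuousLinearMap.smulRightL ℝ F F' (c i) (B y (b i)) := by
    funext y
    refine ContinuousLinearMap.coe_injective (b.ext fun j => ?_)
    simp [c, Finsupp.single_apply, ite_smul]
  rw [e]
  exact ContMDiffAt.sum fun i _ =>
    (ContinuousLinearMap.smulRightL ℝ F F' (c i)).contMDiff.contMDiffAt.comp x (h (b i))

/-- If a pointwise invertible one-form with values in a finite dimensional space is smooth, then
the vector fields on which it is constant are smooth. -/
theorem contMDiff_symm_apply [FiniteDimensional ℝ E] [IsManifold I ∞ N]
    {θ : ∀ u : N, TangentSpace I u ≃ₗ[ℝ] F}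
    (hθ : IsSmooth I.tangent fun v : TangentBundle I N => θ v.proj v.snd) (A : F) :
    ContMDiff I I.tangent ∞ fun u => (⟨u, (θ u).symm A⟩ : TangentBundle I N) := by
  intro u₀
  let e := trivializationAt E (TangentSpace I (M := N)) u₀
  have hu₀ : u₀ ∈ e.baseSet := FiberBundle.mem_baseSet_trivializationAt' u₀
  have hev : ∀ᶠ u in nhds u₀, u ∈ e.baseSet := e.open_baseSet.mem_nhds hu₀
  -- The form read in a local trivialization. It is invertible over the base set, and inversion of
  -- operators is smooth at invertible ones, so the local expression `(B u).inverse A` of the field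
  -- is smooth.
  let B : N → E →L[ℝ] F := fun u =>
    LinearMap.toContinuousLinearMap ((θ u).toLinearMap ∘ₗ (e.symmL ℝ u).toLinearMap)
  have hB : ContMDiffAt I 𝓘(ℝ, E →L[ℝ] F) ∞ B u₀ := by
    refine contMDiffAt_clm_of_apply fun v => contMDiffAt_of_dual fun ℓ => ?_
    have h₁ : ContMDiffAt I I.tangent ∞ (fun u => (⟨u, e.symm u v⟩ : TangentBundle I N)) u₀ := by
      rw [e.contMDiffAt_section_iff hu₀]
      refine (contMDiffAt_const (c := v)).congr_of_eventuallyEq ?_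
      filter_upwards [hev] with u hu
      exact congrArg Prod.snd (e.apply_mk_symm hu v)
    refine ((hθ ℓ).contMDiffAt.comp u₀ h₁).congr_of_eventuallyEq ?_
    filter_upwards [hev] with u hu
    exact congrArg (fun w => ℓ (θ u w)) (e.symmL_apply hu v)
  have hinv : ∀ u ∈ e.baseSet, ∃ L : E ≃L[ℝ] F, (L : E →L[ℝ] F) = B u ∧
      L.symm A = (e ⟨u, (θ u).symm A⟩).2 := by
    intro u hu
    let L := (e.linearEquivAt ℝ u hu).symm.trans (θ u)
    refine ⟨L.toContinuousLinearEquiv, ?_, ?_⟩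
    · ext v
      exact congrArg (θ u) (e.symmL_apply hu v).symm
    · rfl
  obtain ⟨L₀, hL₀, -⟩ := hinv u₀ hu₀
  have hI : ContMDiffAt I 𝓘(ℝ, F →L[ℝ] E) ∞ (fun u => (B u).inverse) u₀ := by
    have h := contDiffAt_map_inverse (n := ∞) L₀
    rw [hL₀] at h
    exact h.contMDiffAt.comp u₀ hB
  rw [e.contMDiffAt_section_iff hu₀]
  have hA : ContMDiffAt I 𝓘(ℝ, E) ∞ (fun u => (B u).inverse A) u₀ :=
    hI.clm_apply contMDiffAt_const
  refine hA.congr_of_eventuallyEq ?_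
  filter_upwards [hev] with u hu
  obtain ⟨L, hL, hLA⟩ := hinv u hu
  rw [← hL, ContinuousLinearMap.inverse_equiv, ← hLA]
  rfl

end FrameFields

/-! ### The fundamental derivative: Leibniz rule, naturality, equivariance -/

section FundamentalDerivative

variable {n m : ℕ}
  {G : Type*} [TopologicalSpace G] [ChartedSpace (EuclideanSpace ℝ (Fin n)) G]
  [Group G] [LieGroup (𝓡 n) ∞ G]
  {P : Subgroup G} [ChartedSpace (EuclideanSpace ℝ (Fin m)) P]
  {𝒢 : Type*} [TopologicalSpace 𝒢] [ChartedSpace (EuclideanSpace ℝ (Fin n)) 𝒢]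
  [IsManifold (𝓡 n) ∞ 𝒢]
  {𝒢' : Type*} [TopologicalSpace 𝒢'] [ChartedSpace (EuclideanSpace ℝ (Fin n)) 𝒢']
  [IsManifold (𝓡 n) ∞ 𝒢']
  (X : CartanBundle n m P 𝒢)

/-- The derivative of a real valued function along the vector field on which the Cartan connection
has the constant value `A`. -/
def frameDeriv (A : 𝔤 n G) (φ : 𝒢 → ℝ) (u : 𝒢) : ℝ :=
  mvfderiv (𝓡 n) φ u ((X.form u).symm A)

theorem contMDiff_frameDeriv (A : 𝔤 n G) {φ : 𝒢 → ℝ} (hφ : ContMDiff (𝓡 n) 𝓘(ℝ, ℝ) ∞ φ) :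
    ContMDiff (𝓡 n) 𝓘(ℝ, ℝ) ∞ (frameDeriv X A φ) :=
  contMDiff_of_contMDiff_tangentMap_snd hφ
    (contMDiff_symm_apply (F := EuclideanSpace ℝ (Fin n)) X.smooth_form A)

theorem frameDeriv_add (A : 𝔤 n G) {φ ψ : 𝒢 → ℝ} (hφ : ContMDiff (𝓡 n) 𝓘(ℝ, ℝ) ∞ φ)
    (hψ : ContMDiff (𝓡 n) 𝓘(ℝ, ℝ) ∞ ψ) (u : 𝒢) :
    frameDeriv X A (fun v => φ v + ψ v) u = frameDeriv X A φ u + frameDeriv X A ψ u := by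
  unfold frameDeriv
  rw [mvfderiv_fun_add (hφ.mdifferentiableAt (by simp)) (hψ.mdifferentiableAt (by simp))]
  rfl

theorem frameDeriv_mul (A : 𝔤 n G) {φ ψ : 𝒢 → ℝ} (hφ : ContMDiff (𝓡 n) 𝓘(ℝ, ℝ) ∞ φ)
    (hψ : ContMDiff (𝓡 n) 𝓘(ℝ, ℝ) ∞ ψ) (u : 𝒢) :
    frameDeriv X A (fun v => φ v * ψ v) u
      = φ u * frameDeriv X A ψ u + frameDeriv X A φ u * ψ u := by
  unfold frameDeriv
  rw [mvfderiv_fun_mul (hφ.mdifferentiableAt (by simp)) (hψ.mdifferentiableAt (by simp))]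
  simp [mul_comm]

theorem frameDeriv_const_mul (A : 𝔤 n G) (c : ℝ) {φ : 𝒢 → ℝ}
    (hφ : ContMDiff (𝓡 n) 𝓘(ℝ, ℝ) ∞ φ) (u : 𝒢) :
    frameDeriv X A (fun v => c * φ v) u = c * frameDeriv X A φ u := by
  rw [frameDeriv_mul X A contMDiff_const hφ]
  simp [frameDeriv, mvfderiv_const]

variable {X} {X' : CartanBundle n m P 𝒢'}

/-- Since `Φ` pulls one connection back to the other, its derivative carries the field with constant
value `A` to the field with constant value `A`. -/
theorem frameDeriv_comp (Φ : CartanMorphism X X') (A : 𝔤 n G) {φ : 𝒢' → ℝ}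
    (hφ : ContMDiff (𝓡 n) 𝓘(ℝ, ℝ) ∞ φ) (u : 𝒢) :
    frameDeriv X A (φ ∘ Φ.toFun) u = frameDeriv X' A φ (Φ.toFun u) := by
  unfold frameDeriv
  rw [mvfderiv_comp_apply u (hφ.mdifferentiableAt (by simp)) (Φ.smooth.mdifferentiableAt (by simp))]
  congr 1
  rw [LinearEquiv.eq_symm_apply, Φ.pullback_form, LinearEquiv.apply_symm_apply]

variable (X)
variable {V : Type*} [AddCommGroup V] [Module ℝ V] [FiniteDimensional ℝ V]

theorem dual_fundDeriv {f : 𝒢 → V} (hf : IsSmooth (𝓡 n) f) (ℓ : Module.Dual ℝ V) (u : 𝒢)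
    (A : 𝔤 n G) : ℓ (fundDeriv X f u A) = frameDeriv X A (fun v => ℓ (f v)) u :=
  dual_vecDeriv hf ℓ u _

theorem isSmooth_fundDeriv {f : 𝒢 → V} (hf : IsSmooth (𝓡 n) f) :
    IsSmooth (𝓡 n) (fundDeriv X f) :=
  isSmooth_of_apply fun A ℓ => by
    simp only [dual_fundDeriv X hf]
    exact contMDiff_frameDeriv X A (hf ℓ)

/-- Evaluation at `B` followed by `ℓ` is itself a functional, so the scalar formula applies twice.
The outer derivative fills the first slot. -/
theorem dual_fundDeriv_fundDeriv {f : 𝒢 → V} (hf : IsSmooth (𝓡 n) f) (ℓ : Module.Dual ℝ V)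
    (u : 𝒢) (A B : 𝔤 n G) :
    ℓ (fundDeriv X (fundDeriv X f) u A B)
      = frameDeriv X A (frameDeriv X B fun v => ℓ (f v)) u := by
  have h := dual_fundDeriv X (isSmooth_fundDeriv X hf) (ℓ ∘ₗ LinearMap.applyₗ B) u A
  simp only [LinearMap.comp_apply, LinearMap.applyₗ_apply_apply, dual_fundDeriv X hf] at h
  exact h

theorem form_symm_act (u : 𝒢) (h : P) (A : 𝔤 n G) :
    (X.form (X.act u h)).symm A
      = mfderiv (𝓡 n) (𝓡 n) (fun x => X.act x h) u ((X.form u).symm (AdRes P h A)) := by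
  rw [LinearEquiv.symm_apply_eq, X.equivariant_form, LinearEquiv.apply_symm_apply,
    Representation.inv_self_apply]


theorem contMDiff_act (h : P) : ContMDiff (𝓡 n) (𝓡 n) ∞ fun u => X.act u h :=
  X.smooth_act.comp (contMDiff_id.prodMk contMDiff_const)

/-- Equivariance comes from differentiating `σ (u h) = ρ h⁻¹ (σ u)` along the field of `Ad(h)A`,
which right translation by `h` maps to the field of `A`. -/
theorem fundDeriv_mem_sections {ρ : Representation ℝ P V} {σ : 𝒢 → V} (hσ : σ ∈ X.sections ρ) :
    fundDeriv X σ ∈ X.sections (coadjointTwist ρ) := by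
  refine ⟨isSmooth_fundDeriv X hσ.1, fun u h => LinearMap.ext fun A => eq_of_forall_dual fun ℓ => ?_⟩
  rw [dual_fundDeriv X hσ.1]
  have e : (fun v => ℓ (σ v)) ∘ (fun x => X.act x h) = fun v => (ℓ ∘ₗ ρ h⁻¹) (σ v) :=
    funext fun v => congrArg ℓ (hσ.2 v h)
  have hc := mvfderiv_comp_apply (f := fun x => X.act x h) (g := fun v => ℓ (σ v)) u
    ((hσ.1 ℓ).mdifferentiableAt (by simp)) ((contMDiff_act X h).mdifferentiableAt (by simp))
    ((X.form u).symm (AdRes P h A))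
  rw [e, ← form_symm_act] at hc
  rw [Representation.linHom_apply, inv_inv]
  exact hc.symm.trans (dual_fundDeriv X hσ.1 (ℓ ∘ₗ ρ h⁻¹) u (AdRes P h A)).symm

end FundamentalDerivative

/-! ### `Ad` acts by Lie algebra automorphisms; invariance of the Killing tensor -/

section Adjoint

variable {n : ℕ}
  {G : Type*} [TopologicalSpace G] [ChartedSpace (EuclideanSpace ℝ (Fin n)) G]
  [Group G] [LieGroup (𝓡 n) ∞ G]

theorem tcast_section {E : Type*} [NormedAddCommGroup E] [NormedSpace ℝ E] {H : Type*}
    [TopologicalSpace H] {I : ModelWithCorners ℝ E H} {N : Type*} [TopologicalSpace N]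
    [ChartedSpace H N] (s : ∀ x : N, TangentSpace I x) {x y : N} (h : x = y) :
    tcast h (s x) = s y := by
  subst h; rfl

theorem tcast_eq_self {E : Type*} [NormedAddCommGroup E] [NormedSpace ℝ E] {H : Type*}
    [TopologicalSpace H] {I : ModelWithCorners ℝ E H} {N : Type*} [TopologicalSpace N]
    [ChartedSpace H N] {x y : N} (h : x = y) (v : E) :
    (tcast (I := I) h v : TangentSpace I y) = (v : E) := by
  subst h; rfl

omit [LieGroup (𝓡 n) ∞ G] in
theorem mulInvariantVectorField_eq_tcast (v : 𝔤 n G) (x : G) :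
    mulInvariantVectorField v x = tcast (mul_one x)
      (mfderiv (𝓡 n) (𝓡 n) (fun y : G => x * y) 1 v) :=
  (tcast_eq_self (I := 𝓡 n) (mul_one x) _).symm

/-- Conjugation by an element of a Lie group. -/
def conjDiffeomorph (g : G) : Diffeomorph (𝓡 n) (𝓡 n) G G ∞ where
  toEquiv := (MulAut.conj g).toEquiv
  contMDiff_toFun := (contMDiff_mul_right (I := 𝓡 n) (n := ∞) (a := g⁻¹)).comp
    (contMDiff_mul_left (I := 𝓡 n) (n := ∞) (a := g))
  contMDiff_invFun := (contMDiff_mul_right (I := 𝓡 n) (n := ∞) (a := g)).comp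
    (contMDiff_mul_left (I := 𝓡 n) (n := ∞) (a := g⁻¹))

theorem isInvertible_mfderiv_conj (g x : G) :
    (mfderiv (𝓡 n) (𝓡 n) (fun y : G => g * y * g⁻¹) x).IsInvertible :=
  ⟨(conjDiffeomorph g).mfderivToContinuousLinearEquiv (by simp) x, rfl⟩

/-- Differentiate at `1` the fact that conjugation by `g` intertwines left translation by `x` with
left translation by `g x g⁻¹`. -/
theorem mfderiv_conj_mulInvariantVectorField (g x : G) (v : 𝔤 n G) :
    mfderiv (𝓡 n) (𝓡 n) (fun y : G => g * y * g⁻¹) x (mulInvariantVectorField v x)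
      = mulInvariantVectorField (adMap g v) (g * x * g⁻¹) := by
  have e : (fun y : G => g * y * g⁻¹) ∘ (fun y => x * y)
      = (fun y => g * x * g⁻¹ * y) ∘ (fun y => g * y * g⁻¹) := by
    ext y; simp [mul_assoc]
  have h := tcast_mfderiv_congr (I := 𝓡 n) (I' := 𝓡 n) e (x := 1) (y := g * x * g⁻¹)
    (by simp) v
  rw [mfderiv_comp (I' := 𝓡 n) (1 : G) (mdifferentiableAt_conj _ _)
    (mdifferentiableAt_mulLeft _ _), mfderiv_comp (I' := 𝓡 n) (1 : G)
    (mdifferentiableAt_mulLeft _ _) (mdifferentiableAt_conj _ _)] at h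
  rw [mulInvariantVectorField_eq_tcast, mulInvariantVectorField_eq_tcast, mfderiv_tcast,
    adMap_apply, mfderiv_tcast, tcast_trans]
  exact h

/-- Conjugation is a diffeomorphism that pulls the left invariant field of `adMap g v` back to that
of `v`. Pullback preserves brackets of fields; evaluate at `1`. -/
theorem adMap_lie (g : G) (v w : 𝔤 n G) : adMap g ⁅v, w⁆ = ⁅adMap g v, adMap g w⁆ := by
  have hpull (v : 𝔤 n G) : VectorField.mpullback (𝓡 n) (𝓡 n) (fun y : G => g * y * g⁻¹)
      (mulInvariantVectorField (adMap g v)) = mulInvariantVectorField v := by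
    funext x
    rw [VectorField.mpullback_apply, ← mfderiv_conj_mulInvariantVectorField]
    exact (isInvertible_mfderiv_conj g x).inverse_apply_self _
  have h := VectorField.mpullback_mlieBracket (I := 𝓡 n) (I' := 𝓡 n) (n := minSmoothness ℝ 3)
    (f := fun y : G => g * y * g⁻¹) (x₀ := 1)
    (mdifferentiableAt_mulInvariantVectorField (adMap g v))
    (mdifferentiableAt_mulInvariantVectorField (adMap g w))
    (contMDiff_mul_right.comp contMDiff_mul_left).contMDiffAt
    (minSmoothness_monotone (by norm_cast))
  rw [hpull, hpull, VectorField.mpullback_apply, ← GroupLieAlgebra.bracket_def] at h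
  rw [adMap_apply, ← h, GroupLieAlgebra.bracket_def]
  rw [(isInvertible_mfderiv_conj g 1).self_apply_inverse]
  exact tcast_section _ _

/-- The adjoint action of `g` as an automorphism of the Lie algebra. -/
def adEquiv (g : G) : 𝔤 n G ≃ₗ⁅ℝ⁆ 𝔤 n G where
  toLinearMap := Ad g
  map_lie' := adMap_lie g _ _
  invFun := Ad g⁻¹
  left_inv v := Representation.inv_self_apply _ g v
  right_inv v := Representation.self_inv_apply _ g v

theorem killing_Ad (g : G) (v w : 𝔤 n G) : killing n G (Ad g v) (Ad g w) = killing n G v w :=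
  LieAlgebra.killingForm_of_equiv_apply (adEquiv g) v w

variable [LieAlgebra.IsSemisimple ℝ (𝔤 n G)]
  {ι : Type*} [Fintype ι] [DecidableEq ι] (ξ : Module.Basis ι ℝ (𝔤 n G))

/-- The identity is the sum of `ξ.coord i ⊗ ξ i`, and the Killing isomorphism sends `ξ.coord i` to
the dual basis vector. -/
theorem killingTensor_eq_sum : killingTensor n G = ∑ i, killingDual ξ i ⊗ₜ[ℝ] ξ i := by
  have h : (dualTensorHomEquiv ℝ (𝔤 n G) (𝔤 n G)).symm LinearMap.id
      = ∑ i, ξ.coord i ⊗ₜ[ℝ] ξ i := by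
    rw [LinearEquiv.symm_apply_eq, map_sum]
    refine ξ.ext fun j => ?_
    simp [LinearMap.sum_apply, Finsupp.single_apply, ite_smul]
  rw [killingTensor, h, map_sum]
  refine Finset.sum_congr rfl fun i _ => ?_
  rw [TensorProduct.map_tmul]
  congr 1
  rw [LinearEquiv.coe_coe, LinearEquiv.symm_apply_eq]
  refine ξ.ext fun j => ?_
  rw [LinearMap.BilinForm.toDual_def, killingDual, LinearMap.BilinForm.apply_dualBasis_left]
  simp [Finsupp.single_apply]

variable {V : Type*} [AddCommGroup V] [Module ℝ V]

theorem killingContraction_apply (Φ : 𝔤 n G →ₗ[ℝ] 𝔤 n G →ₗ[ℝ] V) :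
    killingContraction Φ = ∑ i, Φ (killingDual ξ i) (ξ i) := by
  change TensorProduct.lift Φ (killingTensor n G) = _
  rw [killingTensor_eq_sum ξ, map_sum]
  simp

theorem killingDual_map_Ad (g : G) (i : ι) :
    killingDual (ξ.map (adEquiv g).toLinearEquiv) i = Ad g (killingDual ξ i) := by
  have h : killingDual (ξ.map (adEquiv g).toLinearEquiv)
      = (killingDual ξ).map (adEquiv g).toLinearEquiv := by
    refine Module.Basis.eq_of_apply_eq (congrFun ?_)
    refine (LinearMap.BilinForm.dualBasis_eq_iff _ _ _).2 fun i j => ?_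
    refine (killing_Ad g _ _).trans ?_
    exact LinearMap.BilinForm.apply_dualBasis_left _ _ _ _
  rw [h]
  rfl

/-- The contraction may be computed in any basis. In the basis moved by `Ad g`, the dual basis moves
along, since `Ad g` preserves the Killing form. -/
theorem killingContraction_comp_Ad (Φ : 𝔤 n G →ₗ[ℝ] 𝔤 n G →ₗ[ℝ] V) (g : G) :
    ∑ i, Φ (Ad g (killingDual ξ i)) (Ad g (ξ i)) = killingContraction Φ := by
  rw [killingContraction_apply (ξ.map (adEquiv g).toLinearEquiv)]
  simp only [killingDual_map_Ad]
  rfl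

variable (P : Subgroup G)

theorem killingContraction_coadjointTwist (ρ : Representation ℝ P V) (h : P)
    (Φ : 𝔤 n G →ₗ[ℝ] 𝔤 n G →ₗ[ℝ] V) :
    killingContraction (coadjointTwist (coadjointTwist ρ) h Φ) = ρ h (killingContraction Φ) := by
  let ξ := Module.finBasis ℝ (𝔤 n G)
  rw [killingContraction_apply ξ, ← killingContraction_comp_Ad ξ Φ (h⁻¹ : P), map_sum]
  rfl

end Adjoint

/-! ### The homogeneous model: left translations against left invariant fields -/

section HomogeneousCasimir

theorem mvfderiv_tcast {E : Type*} [NormedAddCommGroup E] [NormedSpace ℝ E] {H : Type*}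
    [TopologicalSpace H] {I : ModelWithCorners ℝ E H} {N : Type*} [TopologicalSpace N]
    [ChartedSpace H N] (φ : N → ℝ) {x y : N} (h : x = y) (v : TangentSpace I x) :
    mvfderiv I φ y (tcast h v) = mvfderiv I φ x v := by
  subst h; rfl

variable {n m : ℕ}
  {G : Type*} [TopologicalSpace G] [ChartedSpace (EuclideanSpace ℝ (Fin n)) G]
  [Group G] [LieGroup (𝓡 n) ∞ G]
  {P : Subgroup G} [ChartedSpace (EuclideanSpace ℝ (Fin m)) P] [LieGroup (𝓡 m) ∞ P]

theorem contMDiff_inv_mul (g : G) : ContMDiff (𝓡 n) (𝓡 n) ∞ fun a : G => a⁻¹ * g :=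
  (contMDiff_mul_right (I := 𝓡 n) (n := ∞) (a := g)).comp (contMDiff_inv (𝓡 n) ∞)

/-- Differentiate the constant `χ (a * a⁻¹)` along the diagonal: the two partial derivatives at `1`
cancel. -/
theorem mvfderiv_comp_inv {χ : G → ℝ} (hχ : ContMDiff (𝓡 n) 𝓘(ℝ, ℝ) ∞ χ) (Z : 𝔤 n G) :
    mvfderiv (𝓡 n) (fun b : G => χ b⁻¹) 1 Z = -mvfderiv (𝓡 n) χ 1 Z := by
  let F : G × G → ℝ := fun p => χ (p.1 * p.2⁻¹)
  have hF : ContMDiff ((𝓡 n).prod (𝓡 n)) 𝓘(ℝ, ℝ) ∞ F :=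
    hχ.comp (contMDiff_fst.mul contMDiff_snd.inv)
  have hc := mvfderiv_comp_apply (I := (𝓡 n).prod (𝓡 n)) (I' := 𝓡 n) (f := fun a : G => (a, a))
    (g := F) 1 (hF.mdifferentiableAt (by simp))
    (mdifferentiableAt_id.prodMk mdifferentiableAt_id) Z
  have hF₀ : F ∘ (fun a : G => (a, a)) = fun _ => χ 1 := by
    funext a
    simp [F]
  have hd : mfderiv (𝓡 n) ((𝓡 n).prod (𝓡 n)) (fun a : G => (a, a)) 1 Z
      = ((Z, Z) : TangentSpace ((𝓡 n).prod (𝓡 n)) ((1 : G), (1 : G))) := by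
    have h : mfderiv (𝓡 n) ((𝓡 n).prod (𝓡 n)) (fun a : G => (a, a)) 1
        = (mfderiv (𝓡 n) (𝓡 n) id (1 : G)).prod (mfderiv (𝓡 n) (𝓡 n) id (1 : G)) :=
      mdifferentiableAt_id.mfderiv_prod mdifferentiableAt_id
    rw [h, mfderiv_id]
    rfl
  have hs : mvfderiv ((𝓡 n).prod (𝓡 n)) F ((1 : G), (1 : G))
        ((Z, Z) : TangentSpace ((𝓡 n).prod (𝓡 n)) ((1 : G), (1 : G)))
      = mvfderiv (𝓡 n) (fun a => F (a, 1)) 1 Z + mvfderiv (𝓡 n) (fun b => F (1, b)) 1 Z :=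
    mfderiv_prod_eq_add_apply (I := 𝓡 n) (I' := 𝓡 n) (f := F) (p := ((1 : G), (1 : G)))
      (v := ((Z, Z) : TangentSpace ((𝓡 n).prod (𝓡 n)) ((1 : G), (1 : G))))
      (hF.mdifferentiableAt (by simp))
  rw [hF₀, mvfderiv_const, hd, hs] at hc
  simp only [F, inv_one, mul_one, one_mul] at hc
  have hc' : (0 : ℝ) = mvfderiv (𝓡 n) χ 1 Z + mvfderiv (𝓡 n) (fun b : G => χ b⁻¹) 1 Z := hc
  linarith

/-- Write `a⁻¹ g` as `g (g⁻¹ a g)⁻¹`: the conjugation contributes `Ad g⁻¹` and the inversion the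
sign. -/
theorem mvfderiv_comp_inv_mul {ψ : G → ℝ} (hψ : ContMDiff (𝓡 n) 𝓘(ℝ, ℝ) ∞ ψ) (X : 𝔤 n G) (g : G) :
    mvfderiv (𝓡 n) (fun a : G => ψ (a⁻¹ * g)) 1 X
      = -mvfderiv (𝓡 n) (fun b : G => ψ (g * b)) 1 (Ad g⁻¹ X) := by
  have hχ : ContMDiff (𝓡 n) 𝓘(ℝ, ℝ) ∞ fun b : G => ψ (g * b) := hψ.comp contMDiff_mul_left
  have hχ' : ContMDiff (𝓡 n) 𝓘(ℝ, ℝ) ∞ fun b : G => ψ (g * b⁻¹) :=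
    hχ.comp (contMDiff_inv (𝓡 n) ∞)
  have e : (fun a : G => ψ (a⁻¹ * g))
      = (fun b : G => ψ (g * b⁻¹)) ∘ (fun a => g⁻¹ * a * g⁻¹⁻¹) := by
    funext a
    simp [mul_assoc]
  rw [e, mvfderiv_comp_apply (I := 𝓡 n) 1 (hχ'.mdifferentiableAt (by simp))
    (mdifferentiableAt_conj g⁻¹ 1), ← mvfderiv_comp_inv hχ]
  exact (mvfderiv_tcast _ _ _).symm

theorem dual_lieAction {V : Type*} [AddCommGroup V] [Module ℝ V] [FiniteDimensional ℝ V]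
    {f : G → V} (hf : IsSmooth (𝓡 n) f) (X : 𝔤 n G) (ℓ : Module.Dual ℝ V) (g : G) :
    ℓ (lieAction X f g) = mvfderiv (𝓡 n) (fun a : G => ℓ (f (a⁻¹ * g))) 1 X :=
  dual_vecDeriv (hf.comp_contMDiff (contMDiff_inv_mul g)) ℓ 1 X

theorem contMDiff_mvfderiv_inv_mul {φ : G → ℝ} (hφ : ContMDiff (𝓡 n) 𝓘(ℝ, ℝ) ∞ φ) (Y : 𝔤 n G) :
    ContMDiff (𝓡 n) 𝓘(ℝ, ℝ) ∞ fun g => mvfderiv (𝓡 n) (fun a : G => φ (a⁻¹ * g)) 1 Y :=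
  contMDiff_mvfderiv_slice (F := fun p : G × G => φ (p.1⁻¹ * p.2))
    (hφ.comp (contMDiff_fst.inv.mul contMDiff_snd)) 1 Y

theorem isSmooth_lieAction {V : Type*} [AddCommGroup V] [Module ℝ V] [FiniteDimensional ℝ V]
    {f : G → V} (hf : IsSmooth (𝓡 n) f) (X : 𝔤 n G) : IsSmooth (𝓡 n) (lieAction X f) :=
  fun ℓ => by
    simp only [dual_lieAction hf]
    exact contMDiff_mvfderiv_inv_mul (hf ℓ) X

theorem frameDeriv_homogeneousModel (hP : IsParabolicSubgroup n m P) (A : 𝔤 n G) {ψ : G → ℝ}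
    (hψ : ContMDiff (𝓡 n) 𝓘(ℝ, ℝ) ∞ ψ) (g : G) :
    frameDeriv (homogeneousModel P hP) A ψ g
      = mvfderiv (𝓡 n) (fun b : G => ψ (g * b)) 1 A := by
  have h := mvfderiv_comp_apply (I := 𝓡 n) (f := fun b : G => g * b) (g := ψ) 1
    (hψ.mdifferentiableAt (by simp)) (mdifferentiableAt_mulLeft g 1) A
  exact (mvfderiv_tcast ψ (mul_one g) _).trans h.symm

/-- The outer action of `X` turns into a right hand derivative along `Ad g⁻¹ X`; the outer frame
derivative along `Ad g⁻¹ Y` turns back into the action of `Y`. What remains is that derivatives on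
the left and on the right of `g` commute. -/
theorem lieAction_lieAction (hP : IsParabolicSubgroup n m P)
    {V : Type*} [AddCommGroup V] [Module ℝ V] [FiniteDimensional ℝ V]
    {f : G → V} (hf : IsSmooth (𝓡 n) f) (X Y : 𝔤 n G) (g : G) :
    lieAction X (lieAction Y f) g
      = fundDeriv (homogeneousModel P hP) (fundDeriv (homogeneousModel P hP) f) g
          (Ad g⁻¹ Y) (Ad g⁻¹ X) := by
  refine eq_of_forall_dual fun ℓ => ?_
  have hφ := hf ℓ
  have hD := contMDiff_frameDeriv (homogeneousModel P hP) (Ad g⁻¹ X) hφ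
  rw [dual_fundDeriv_fundDeriv _ hf, dual_lieAction (isSmooth_lieAction hf Y)]
  simp only [dual_lieAction hf]
  rw [mvfderiv_comp_inv_mul (contMDiff_mvfderiv_inv_mul hφ Y),
    frameDeriv_homogeneousModel hP _ hD, neg_eq_iff_eq_neg, ← mvfderiv_comp_inv_mul hD]
  simp only [frameDeriv_homogeneousModel hP _ hφ, mul_assoc]
  -- The first variable moves `g` on the right, the second on the left.
  exact mvfderiv_mvfderiv_comm (F := fun p : G × G => ℓ (f (p.2⁻¹ * (g * p.1))))
    (hφ.comp (contMDiff_snd.inv.mul (contMDiff_const.mul contMDiff_fst))) 1 1 _ _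

variable [LieAlgebra.IsSemisimple ℝ (𝔤 n G)]

/-- The reversal of order in `lieAction_lieAction` puts the dual basis in the first slot, exactly as
in `killingTensor_eq_sum`. -/
theorem casimir_eq_curvedCasimir (hP : IsParabolicSubgroup n m P)
    {V : Type*} [AddCommGroup V] [Module ℝ V] [FiniteDimensional ℝ V]
    {f : G → V} (hf : IsSmooth (𝓡 n) f)
    {ι : Type*} [Fintype ι] [DecidableEq ι] (ξ : Module.Basis ι ℝ (𝔤 n G)) :
    casimir ξ f = curvedCasimir (homogeneousModel P hP) f := by
  funext g
  rw [casimir, Finset.sum_apply, curvedCasimir, ← killingContraction_comp_Ad ξ _ g⁻¹]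
  exact Finset.sum_congr rfl fun i _ => lieAction_lieAction hP hf _ _ g

end HomogeneousCasimir

/-! ### The curved Casimir operator: scalar form, order, invariance -/

section CurvedCasimirOperator

variable {n m d : ℕ}
  {G : Type*} [TopologicalSpace G] [ChartedSpace (EuclideanSpace ℝ (Fin n)) G]
  [Group G] [LieGroup (𝓡 n) ∞ G] [LieAlgebra.IsSemisimple ℝ (𝔤 n G)]
  {P : Subgroup G} [ChartedSpace (EuclideanSpace ℝ (Fin m)) P]
  {𝒢 : Type*} [TopologicalSpace 𝒢] [ChartedSpace (EuclideanSpace ℝ (Fin n)) 𝒢]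
  [IsManifold (𝓡 n) ∞ 𝒢]
  {𝒢' : Type*} [TopologicalSpace 𝒢'] [ChartedSpace (EuclideanSpace ℝ (Fin n)) 𝒢']
  [IsManifold (𝓡 n) ∞ 𝒢']
  {M : Type*} [TopologicalSpace M] [ChartedSpace (EuclideanSpace ℝ (Fin d)) M]
  {V : Type*} [AddCommGroup V] [Module ℝ V] [FiniteDimensional ℝ V]

/-- The second order operator `∑ Aˡ · Aₗ · φ` on real valued functions, where `Aˡ` and `Aₗ` are the
vector fields corresponding to a basis of the Lie algebra and its dual basis. -/
def scalarCasimir (X : CartanBundle n m P 𝒢) (φ : 𝒢 → ℝ) (u : 𝒢) : ℝ :=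
  ∑ i, frameDeriv X (killingDual (Module.finBasis ℝ (𝔤 n G)) i)
    (frameDeriv X (Module.finBasis ℝ (𝔤 n G) i) φ) u

variable (X : CartanBundle n m P 𝒢)

theorem dual_curvedCasimir {f : 𝒢 → V} (hf : IsSmooth (𝓡 n) f) (ℓ : Module.Dual ℝ V) (u : 𝒢) :
    ℓ (curvedCasimir X f u) = scalarCasimir X (fun v => ℓ (f v)) u := by
  rw [curvedCasimir, killingContraction_apply (Module.finBasis ℝ (𝔤 n G)), map_sum]
  exact Finset.sum_congr rfl fun i _ => dual_fundDeriv_fundDeriv X hf ℓ u _ _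

theorem curvedCasimir_mem_sections {ρ : Representation ℝ P V} {σ : 𝒢 → V}
    (hσ : σ ∈ X.sections ρ) : curvedCasimir X σ ∈ X.sections ρ := by
  have h := fundDeriv_mem_sections X (fundDeriv_mem_sections X hσ)
  refine ⟨h.1.linearMap_comp killingContraction, fun u p => ?_⟩
  rw [curvedCasimir, h.2 u p, killingContraction_coadjointTwist]
  rfl

theorem scalarCasimir_add {φ ψ : 𝒢 → ℝ} (hφ : ContMDiff (𝓡 n) 𝓘(ℝ, ℝ) ∞ φ)
    (hψ : ContMDiff (𝓡 n) 𝓘(ℝ, ℝ) ∞ ψ) (u : 𝒢) :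
    scalarCasimir X (fun v => φ v + ψ v) u = scalarCasimir X φ u + scalarCasimir X ψ u := by
  simp only [scalarCasimir, ← Finset.sum_add_distrib]
  refine Finset.sum_congr rfl fun i _ => ?_
  rw [← frameDeriv_add X _ (contMDiff_frameDeriv X _ hφ) (contMDiff_frameDeriv X _ hψ)]
  congr 1
  exact funext fun v => frameDeriv_add X _ hφ hψ v

/-- The symmetric bilinear first order operator that measures the failure of `scalarCasimir` to be
a derivation. -/
def scalarCarre (X : CartanBundle n m P 𝒢) (φ ψ : 𝒢 → ℝ) (u : 𝒢) : ℝ :=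
  ∑ i, (frameDeriv X (killingDual (Module.finBasis ℝ (𝔤 n G)) i) φ u
      * frameDeriv X (Module.finBasis ℝ (𝔤 n G) i) ψ u
    + frameDeriv X (Module.finBasis ℝ (𝔤 n G) i) φ u
      * frameDeriv X (killingDual (Module.finBasis ℝ (𝔤 n G)) i) ψ u)

theorem scalarCasimir_mul {φ ψ : 𝒢 → ℝ} (hφ : ContMDiff (𝓡 n) 𝓘(ℝ, ℝ) ∞ φ)
    (hψ : ContMDiff (𝓡 n) 𝓘(ℝ, ℝ) ∞ ψ) (u : 𝒢) :
    scalarCasimir X (fun v => φ v * ψ v) u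
      = φ u * scalarCasimir X ψ u + scalarCarre X φ ψ u + scalarCasimir X φ u * ψ u := by
  simp only [scalarCasimir, scalarCarre, Finset.mul_sum, Finset.sum_mul, ← Finset.sum_add_distrib]
  refine Finset.sum_congr rfl fun i _ => ?_
  set A := killingDual (Module.finBasis ℝ (𝔤 n G)) i
  set B := Module.finBasis ℝ (𝔤 n G) i
  have hB : frameDeriv X B (fun v => φ v * ψ v)
      = fun v => φ v * frameDeriv X B ψ v + frameDeriv X B φ v * ψ v :=
    funext fun v => frameDeriv_mul X B hφ hψ v
  have hBφ := contMDiff_frameDeriv X B hφ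
  have hBψ := contMDiff_frameDeriv X B hψ
  rw [hB, frameDeriv_add X A (φ := fun v => φ v * frameDeriv X B ψ v)
    (ψ := fun v => frameDeriv X B φ v * ψ v) (hφ.mul hBψ) (hBφ.mul hψ), frameDeriv_mul X A hφ hBψ,
    frameDeriv_mul X A hBφ hψ]
  ring

/-- With `φ` fixed this is a derivation, so its commutator with multiplication by `ψ` is
multiplication by a function. -/
theorem scalarCarre_mul_right {φ ψ χ : 𝒢 → ℝ} (hψ : ContMDiff (𝓡 n) 𝓘(ℝ, ℝ) ∞ ψ)
    (hχ : ContMDiff (𝓡 n) 𝓘(ℝ, ℝ) ∞ χ) (u : 𝒢) :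
    scalarCarre X φ (fun v => ψ v * χ v) u
      = ψ u * scalarCarre X φ χ u + scalarCarre X φ ψ u * χ u := by
  simp only [scalarCarre, Finset.mul_sum, Finset.sum_mul, ← Finset.sum_add_distrib]
  refine Finset.sum_congr rfl fun i _ => ?_
  rw [frameDeriv_mul X _ hψ hχ, frameDeriv_mul X _ hψ hχ]
  ring

theorem scalarCasimir_const_mul (c : ℝ) {φ : 𝒢 → ℝ} (hφ : ContMDiff (𝓡 n) 𝓘(ℝ, ℝ) ∞ φ) (u : 𝒢) :
    scalarCasimir X (fun v => c * φ v) u = c * scalarCasimir X φ u := by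
  simp only [scalarCasimir, Finset.mul_sum]
  refine Finset.sum_congr rfl fun i _ => ?_
  rw [← frameDeriv_const_mul X _ c (contMDiff_frameDeriv X _ hφ)]
  congr 1
  exact funext fun v => frameDeriv_const_mul X _ c hφ v

/-- The curved Casimir operator on the sections of a natural bundle. -/
def curvedCasimirOp (ρ : Representation ℝ P V) : X.sections ρ →ₗ[ℝ] X.sections ρ where
  toFun σ := ⟨curvedCasimir X σ.1, curvedCasimir_mem_sections X σ.2⟩
  map_add' σ τ := by
    refine Subtype.ext (funext fun u => eq_of_forall_dual fun ℓ => ?_)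
    change ℓ (curvedCasimir X (σ + τ : X.sections ρ).1 u)
      = ℓ (curvedCasimir X σ.1 u + curvedCasimir X τ.1 u)
    rw [map_add, dual_curvedCasimir X (σ + τ).2.1, dual_curvedCasimir X σ.2.1,
      dual_curvedCasimir X τ.2.1, ← scalarCasimir_add X (σ.2.1 ℓ) (τ.2.1 ℓ)]
    simp only [Submodule.coe_add, Pi.add_apply, map_add]
  map_smul' c σ := by
    refine Subtype.ext (funext fun u => eq_of_forall_dual fun ℓ => ?_)
    change ℓ (curvedCasimir X (c • σ : X.sections ρ).1 u) = ℓ (c • curvedCasimir X σ.1 u)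
    rw [map_smul, dual_curvedCasimir X (c • σ).2.1, dual_curvedCasimir X σ.2.1, smul_eq_mul,
      ← scalarCasimir_const_mul X c (σ.2.1 ℓ)]
    simp only [Submodule.coe_smul, Pi.smul_apply, map_smul, smul_eq_mul]

theorem isDifferentialOperator_curvedCasimirOp (Y : CartanGeometry n m d P 𝒢 M)
    (ρ : Representation ℝ P V) :
    Y.IsDifferentialOperator ρ 2 (curvedCasimirOp Y.toCartanBundle ρ) := by
  set X := Y.toCartanBundle
  intro φ₁ φ₂ φ₃
  let L := curvedCasimirOp X ρ
  let a := fun (φ : C^∞⟮𝓡 d, M; 𝓘(ℝ, ℝ), ℝ⟯) (u : 𝒢) => φ (Y.proj u)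
  have ha (φ) : ContMDiff (𝓡 n) 𝓘(ℝ, ℝ) ∞ (a φ) := φ.contMDiff.comp Y.smooth_proj
  have hm (φ) (σ : Y.sections ρ) (u : 𝒢) : (Y.mulOp ρ φ σ).1 u = a φ u • σ.1 u := rfl
  have hL (σ : Y.sections ρ) (ℓ : Module.Dual ℝ V) (u : 𝒢) :
      ℓ ((L σ).1 u) = scalarCasimir X (fun v => ℓ (σ.1 v)) u := dual_curvedCasimir X σ.2.1 ℓ u
  -- The first commutator is a first order operator: the second order term cancels by
  -- `scalarCasimir_mul`.
  have h₁ (φ) (σ : Y.sections ρ) (ℓ : Module.Dual ℝ V) (u : 𝒢) :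
      ℓ (((L ∘ₗ Y.mulOp ρ φ - Y.mulOp ρ φ ∘ₗ L) σ).1 u)
        = scalarCarre X (a φ) (fun v => ℓ (σ.1 v)) u + scalarCasimir X (a φ) u * ℓ (σ.1 u) := by
    change ℓ ((L (Y.mulOp ρ φ σ)).1 u - (Y.mulOp ρ φ (L σ)).1 u) = _
    rw [map_sub, hL, hm, map_smul, hL]
    simp only [hm, map_smul, smul_eq_mul]
    rw [scalarCasimir_mul X (ha φ) (σ.2.1 ℓ)]
    ring
  -- The second commutator is multiplication by a function, which commutes with every other
  -- multiplication; so the third one vanishes.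
  have h₂ (φ ψ) (σ : Y.sections ρ) (ℓ : Module.Dual ℝ V) (u : 𝒢) :
      ℓ ((((L ∘ₗ Y.mulOp ρ φ - Y.mulOp ρ φ ∘ₗ L) ∘ₗ Y.mulOp ρ ψ
        - Y.mulOp ρ ψ ∘ₗ (L ∘ₗ Y.mulOp ρ φ - Y.mulOp ρ φ ∘ₗ L)) σ).1 u)
        = scalarCarre X (a φ) (a ψ) u * ℓ (σ.1 u) := by
    set K := L ∘ₗ Y.mulOp ρ φ - Y.mulOp ρ φ ∘ₗ L
    change ℓ ((K (Y.mulOp ρ ψ σ)).1 u - (Y.mulOp ρ ψ (K σ)).1 u) = _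
    rw [map_sub, h₁, hm, hm, map_smul, map_smul, h₁]
    simp only [hm, map_smul, smul_eq_mul]
    rw [scalarCarre_mul_right X (ha ψ) (σ.2.1 ℓ)]
    ring
  refine LinearMap.ext fun σ => Subtype.ext (funext fun u => eq_of_forall_dual fun ℓ => ?_)
  set K := (L ∘ₗ Y.mulOp ρ φ₁ - Y.mulOp ρ φ₁ ∘ₗ L) ∘ₗ Y.mulOp ρ φ₂
        - Y.mulOp ρ φ₂ ∘ₗ (L ∘ₗ Y.mulOp ρ φ₁ - Y.mulOp ρ φ₁ ∘ₗ L)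
  change ℓ ((K (Y.mulOp ρ φ₃ σ)).1 u - (Y.mulOp ρ φ₃ (K σ)).1 u) = ℓ 0
  rw [map_sub, h₂, hm, hm, map_smul, map_smul, h₂, map_zero, smul_eq_mul, smul_eq_mul]
  ring

variable {X} {X' : CartanBundle n m P 𝒢'}

omit [LieAlgebra.IsSemisimple ℝ (𝔤 n G)] [FiniteDimensional ℝ V] in
theorem comp_mem_sections (Φ : CartanMorphism X X') {ρ : Representation ℝ P V} {σ : 𝒢' → V}
    (hσ : σ ∈ X'.sections ρ) : σ ∘ Φ.toFun ∈ X.sections ρ :=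
  ⟨hσ.1.comp_contMDiff Φ.smooth, fun u h => by
    simp only [Function.comp_apply, Φ.map_act, hσ.2]⟩

/-- Both geometries use the same basis of the same Lie algebra, so naturality of `frameDeriv`, used
twice, matches the sums term by term. -/
theorem curvedCasimir_comp (Φ : CartanMorphism X X') {f : 𝒢' → V} (hf : IsSmooth (𝓡 n) f) :
    curvedCasimir X (f ∘ Φ.toFun) = curvedCasimir X' f ∘ Φ.toFun := by
  refine funext fun u => eq_of_forall_dual fun ℓ => ?_
  rw [dual_curvedCasimir X (hf.comp_contMDiff Φ.smooth), Function.comp_apply,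
    dual_curvedCasimir X' hf]
  refine Finset.sum_congr rfl fun i _ => ?_
  rw [← frameDeriv_comp Φ _ (contMDiff_frameDeriv X' _ (hf ℓ))]
  congr 1
  exact funext fun v => frameDeriv_comp Φ _ (hf ℓ) v

end CurvedCasimirOperator
end CurvedCasimir

end

/-! ### The proposition -/

open CurvedCasimir in
theorem proposition2p4 {n m : ℕ}
    -- a semisimple Lie group `G`
    {G : Type*} [TopologicalSpace G] [ChartedSpace (EuclideanSpace ℝ (Fin n)) G]
    [Group G] [LieGroup (𝓡 n) ∞ G] [LieAlgebra.IsSemisimple ℝ (𝔤 n G)]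
    -- a parabolic subgroup `P`
    (P : Subgroup G) [ChartedSpace (EuclideanSpace ℝ (Fin m)) P] [LieGroup (𝓡 m) ∞ P]
    (hP : IsParabolicSubgroup n m P)
    -- a finite dimensional (continuous) representation `W` of `P`
    {W : Type*} [AddCommGroup W] [Module ℝ W] [FiniteDimensional ℝ W]
    (ρ : Representation ℝ P W)
    (hρ : ∀ (w : W) (ℓ : Module.Dual ℝ W), Continuous fun h : P => ℓ (ρ h w)) :
    -- the homogeneous model
    (∀ σ ∈ (homogeneousModel P hP).sections ρ,
      fundDeriv (homogeneousModel P hP) σ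
        ∈ (homogeneousModel P hP).sections (coadjointTwist ρ) ∧
      fundDeriv (homogeneousModel P hP) (fundDeriv (homogeneousModel P hP) σ)
        ∈ (homogeneousModel P hP).sections (coadjointTwist (coadjointTwist ρ)) ∧
      curvedCasimir (homogeneousModel P hP) σ ∈ (homogeneousModel P hP).sections ρ ∧
      ∀ (ι : Type) [Fintype ι] [DecidableEq ι] (ξ : Module.Basis ι ℝ (𝔤 n G)),
        casimir ξ σ = curvedCasimir (homogeneousModel P hP) σ) ∧
    -- on every parabolic geometry, a differential operator of order at most two
    (∀ (d : ℕ) (𝒢 : Type*) [TopologicalSpace 𝒢] [ChartedSpace (EuclideanSpace ℝ (Fin n)) 𝒢]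
      [IsManifold (𝓡 n) ∞ 𝒢] (M : Type*) [TopologicalSpace M] [T2Space M]
      [ChartedSpace (EuclideanSpace ℝ (Fin d)) M] [IsManifold (𝓡 d) ∞ M]
      (Y : CartanGeometry n m d P 𝒢 M),
      (∀ σ ∈ Y.sections ρ,
        fundDeriv Y.toCartanBundle σ ∈ Y.sections (coadjointTwist ρ) ∧
        fundDeriv Y.toCartanBundle (fundDeriv Y.toCartanBundle σ)
          ∈ Y.sections (coadjointTwist (coadjointTwist ρ))) ∧
      ∃ L : Y.sections ρ →ₗ[ℝ] Y.sections ρ,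
        (∀ σ : Y.sections ρ, (L σ : 𝒢 → W) = curvedCasimir Y.toCartanBundle (σ : 𝒢 → W)) ∧
        Y.IsDifferentialOperator ρ 2 L) ∧
    -- invariance under morphisms of parabolic geometries
    (∀ (d : ℕ) (𝒢 : Type*) [TopologicalSpace 𝒢] [ChartedSpace (EuclideanSpace ℝ (Fin n)) 𝒢]
      [IsManifold (𝓡 n) ∞ 𝒢] (M : Type*) [TopologicalSpace M] [T2Space M]
      [ChartedSpace (EuclideanSpace ℝ (Fin d)) M] [IsManifold (𝓡 d) ∞ M]
      (𝒢' : Type*) [TopologicalSpace 𝒢'] [ChartedSpace (EuclideanSpace ℝ (Fin n)) 𝒢']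
      [IsManifold (𝓡 n) ∞ 𝒢'] (M' : Type*) [TopologicalSpace M'] [T2Space M']
      [ChartedSpace (EuclideanSpace ℝ (Fin d)) M'] [IsManifold (𝓡 d) ∞ M']
      (Y : CartanGeometry n m d P 𝒢 M) (Y' : CartanGeometry n m d P 𝒢' M')
      (Φ : CartanMorphism Y.toCartanBundle Y'.toCartanBundle),
      ∀ σ ∈ Y'.sections ρ,
        σ ∘ Φ.toFun ∈ Y.sections ρ ∧
        curvedCasimir Y.toCartanBundle (σ ∘ Φ.toFun)
          = curvedCasimir Y'.toCartanBundle σ ∘ Φ.toFun) := by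
  refine ⟨fun σ hσ => ?_, ?_, ?_⟩
  · have h₁ := fundDeriv_mem_sections _ hσ
    exact ⟨h₁, fundDeriv_mem_sections _ h₁, curvedCasimir_mem_sections _ hσ,
      fun ι _ _ ξ => casimir_eq_curvedCasimir hP hσ.1 ξ⟩
  · intro d 𝒢 _ _ _ M _ _ _ _ Y
    refine ⟨fun σ hσ => ?_, curvedCasimirOp Y.toCartanBundle ρ, fun σ => rfl,
      isDifferentialOperator_curvedCasimirOp Y ρ⟩
    have h₁ := fundDeriv_mem_sections _ hσ
    exact ⟨h₁, fundDeriv_mem_sections _ h₁⟩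
  · intro d 𝒢 _ _ _ M _ _ _ _ 𝒢' _ _ _ M' _ _ _ _ Y Y' Φ σ hσ
    exact ⟨comp_mem_sections Φ hσ, curvedCasimir_comp Φ hσ.1⟩
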